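/- Let $(M,g)$ be a compact connected smooth Riemannian manifold, possibly with boundary, and let $\phi\in C^2(M)$. Integrals over $M$ are taken with respect to the weighted measure $e^{-\phi}\,dV_g$, and $V_\phi=\int_M e^{-\phi}\,dV_g$ is the weighted volume. Let $H^1(M)$ be the Sobolev space of $(M,g,\phi)$, that is, the completion of $C^\infty(M)$ in the norm $\left(\int_M (u^2+|\nabla u|^2)\,e^{-\phi}\,dV_g\right)^{1/2}$, and let $\lambda_1$ be the first nonzero eigenvalue of the Bakry-Émery Laplacian $-\Delta_\phi=-(\Delta-\nabla\phi\cdot\nabla)$ on $M$ (with the Neumann boundary condition if $\partial M\neq\emptyset$), realised as the self-adjoint operator of the Dirichlet form $\int_M\langle\nabla u,\nabla v\rangle\,e^{-\phi}\,dV_g$ on $H^1(M)$. Suppose that, for some constants $\nu>2$, $\alpha\in\mathbb R$ and $C_o>0$, the Sobolev inequality $$\left(\int_M |u|^{\frac{2\nu}{\nu-2}}\,e^{-\phi}\,dV_g\right)^{\frac{\nu-2}{\nu}}\le C_o\,V_\phi^{-\frac2\nu}\int_M\left(|\nabla u|^2+\alpha|u|^2\right)e^{-\phi}\,dV_g \tag{S}$$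 holds for all $u\in H^1(M)$. Then every $u\in H^1(M)$ with $\int_M u\,e^{-\phi}\,dV_g=0$ satisfies $$\int_M|\nabla u|^2\,e^{-\phi}\,dV_g\ \ge\ C_1\left(\int_M u^2\,e^{-\phi}\,dV_g\right)^{\frac{2+\nu}{\nu}}\left(\int_M|u|\,e^{-\phi}\,dV_g\right)^{-\frac4\nu},\qquad C_1=\frac{\lambda_1\,V_\phi^{2/\nu}}{C_o\,(\lambda_1+\alpha)},$$ where the right-hand side is read as $0$ if $u=0$ almost everywhere. -/

import Mathlib

open MeasureTheory Filter Set Bundle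
open scoped Manifold ContDiff Bundle Topology ENNReal

noncomputable section

namespace BakryEmery

section Volume

/-- The coordinate vector field `∂ᵢ` of the preferred chart at `x₀`, at the point of `M` with
coordinates `y`. -/
def coordVector {n : ℕ} {H : Type*} [TopologicalSpace H]
    (I : ModelWithCorners ℝ (EuclideanSpace ℝ (Fin n)) H)
    {M : Type*} [TopologicalSpace M] [ChartedSpace H M]
    (x₀ : M) (y : EuclideanSpace ℝ (Fin n)) (i : Fin n) :
    TangentSpace I ((extChartAt I x₀).symm y) :=
  mfderivWithin 𝓘(ℝ, EuclideanSpace ℝ (Fin n)) I (extChartAt I x₀).symm (range I) y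
    (EuclideanSpace.single i (1 : ℝ))

/-- The Riemannian volume density `√(det gᵢⱼ)` in the preferred chart at `x₀`, as a function of
the coordinates. -/
def volumeDensity {n : ℕ} {H : Type*} [TopologicalSpace H]
    (I : ModelWithCorners ℝ (EuclideanSpace ℝ (Fin n)) H)
    {M : Type*} [TopologicalSpace M] [ChartedSpace H M]
    [RiemannianBundle (fun x : M ↦ TangentSpace I x)]
    (x₀ : M) (y : EuclideanSpace ℝ (Fin n)) : ℝ :=
  Real.sqrt (Matrix.det (Matrix.of fun i j : Fin n ↦
    inner ℝ (coordVector I x₀ y i) (coordVector I x₀ y j)))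

/-- The measure `√(det gᵢⱼ) dy¹ ⋯ dyⁿ` of the preferred chart at `x₀`, transported to `M`
(it vanishes outside the chart domain). -/
def chartVolume {n : ℕ} {H : Type*} [TopologicalSpace H]
    (I : ModelWithCorners ℝ (EuclideanSpace ℝ (Fin n)) H)
    {M : Type*} [TopologicalSpace M] [ChartedSpace H M] [MeasurableSpace M]
    [RiemannianBundle (fun x : M ↦ TangentSpace I x)]
    (x₀ : M) : Measure M :=
  Measure.map (extChartAt I x₀).symm
    ((volume.restrict (extChartAt I x₀).target).withDensity
      fun y ↦ ENNReal.ofReal (volumeDensity I x₀ y))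

/-- The Riemannian volume measure `dV_g`: the smallest measure on `M` that dominates
`√(det gᵢⱼ) dy¹ ⋯ dyⁿ` in every chart. By the change of variables formula the chart measures agree
on overlaps, so that this is the measure which coincides with each of them on its chart domain. -/
def riemannianVolume {n : ℕ} {H : Type*} [TopologicalSpace H]
    (I : ModelWithCorners ℝ (EuclideanSpace ℝ (Fin n)) H)
    (M : Type*) [TopologicalSpace M] [ChartedSpace H M] [MeasurableSpace M]
    [RiemannianBundle (fun x : M ↦ TangentSpace I x)] : Measure M :=
  ⨆ x₀ : M, chartVolume I x₀

/-- The weighted measure `e^{-φ} dV_g`. -/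
def weightedVolume {n : ℕ} {H : Type*} [TopologicalSpace H]
    (I : ModelWithCorners ℝ (EuclideanSpace ℝ (Fin n)) H)
    {M : Type*} [TopologicalSpace M] [ChartedSpace H M] [MeasurableSpace M]
    [RiemannianBundle (fun x : M ↦ TangentSpace I x)] (φ : M → ℝ) : Measure M :=
  (riemannianVolume I M).withDensity fun x ↦ ENNReal.ofReal (Real.exp (-φ x))

end Volume

section Sobolev

/-- The Riemannian gradient of a (differentiable) function `f`: the vector field `∇f` with
`⟨∇f, v⟩ = df(v)`. -/
def gradient {n : ℕ} {H : Type*} [TopologicalSpace H]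
    (I : ModelWithCorners ℝ (EuclideanSpace ℝ (Fin n)) H)
    {M : Type*} [TopologicalSpace M] [ChartedSpace H M]
    [RiemannianBundle (fun x : M ↦ TangentSpace I x)]
    (f : M → ℝ) (x : M) : TangentSpace I x :=
  haveI : FiniteDimensional ℝ (TangentSpace I x) :=
    inferInstanceAs (FiniteDimensional ℝ (EuclideanSpace ℝ (Fin n)))
  haveI : CompleteSpace (TangentSpace I x) := FiniteDimensional.complete ℝ _
  (InnerProductSpace.toDual ℝ (TangentSpace I x)).symm (mfderiv I 𝓘(ℝ, ℝ) f x)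

/-- `u ∈ H¹(M)` with gradient `∇u = X`. Here `H¹(M)` is the completion of `C^∞(M)` in the norm
`(∫ (u² + |∇u|²) e^{-φ})^{1/2}`: there are smooth functions `f k` (smooth up to the boundary, if
there is one) with `f k → u` and `∇(f k) → X` in the weighted `L²` norm. -/
def HasGradient {n : ℕ} {H : Type*} [TopologicalSpace H]
    (I : ModelWithCorners ℝ (EuclideanSpace ℝ (Fin n)) H)
    {M : Type*} [TopologicalSpace M] [ChartedSpace H M] [MeasurableSpace M]
    [RiemannianBundle (fun x : M ↦ TangentSpace I x)] (φ : M → ℝ)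
    (u : M → ℝ) (X : (x : M) → TangentSpace I x) : Prop :=
  ∃ f : ℕ → M → ℝ,
    (∀ k, ContMDiff I 𝓘(ℝ, ℝ) ∞ (f k)) ∧
    (∀ k, MemLp (fun x ↦ f k x - u x) 2 (weightedVolume I φ)) ∧
    (∀ k, MemLp (fun x ↦ ‖gradient I (f k) x - X x‖) 2 (weightedVolume I φ)) ∧
    Tendsto (fun k ↦ eLpNorm (fun x ↦ f k x - u x) 2 (weightedVolume I φ)) atTop (𝓝 0) ∧
    Tendsto (fun k ↦ eLpNorm (fun x ↦ ‖gradient I (f k) x - X x‖) 2 (weightedVolume I φ))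
      atTop (𝓝 0)

/-- The Sobolev inequality (S) with constants `ν`, `α`, `C₀`:
`(∫ |u|^{2ν/(ν-2)} e^{-φ})^{(ν-2)/ν} ≤ C₀ V_φ^{-2/ν} ∫ (|∇u|² + α |u|²) e^{-φ}` for all
`u ∈ H¹(M)`, the left-hand side being finite. -/
def SobolevInequality {n : ℕ} {H : Type*} [TopologicalSpace H]
    (I : ModelWithCorners ℝ (EuclideanSpace ℝ (Fin n)) H)
    {M : Type*} [TopologicalSpace M] [ChartedSpace H M] [MeasurableSpace M]
    [RiemannianBundle (fun x : M ↦ TangentSpace I x)] (φ : M → ℝ) (ν α C₀ : ℝ) : Prop :=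
  ∀ (u : M → ℝ) (X : (x : M) → TangentSpace I x), HasGradient I φ u X →
    Integrable (fun x ↦ |u x| ^ (2 * ν / (ν - 2))) (weightedVolume I φ) ∧
    (∫ x, |u x| ^ (2 * ν / (ν - 2)) ∂weightedVolume I φ) ^ ((ν - 2) / ν) ≤
      C₀ * (weightedVolume I φ).real univ ^ (-(2 / ν)) *
        ∫ x, (‖X x‖ ^ 2 + α * |u x| ^ 2) ∂weightedVolume I φ

end Sobolev

section Spectrum

/-- `u` is in the domain of the self-adjoint operator `-Δ_φ` on the weighted `L²` space and
`-Δ_φ u = w`. The operator is the one associated with the Dirichlet form `∫ ⟨∇u, ∇v⟩ e^{-φ}` on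
`H¹(M)` (the Friedrichs extension of `Δ_φ = Δ - ∇φ·∇` on `C^∞(M)` for `∂M = ∅`, the Neumann
realisation for `∂M ≠ ∅`). -/
def HasNegLaplacian {n : ℕ} {H : Type*} [TopologicalSpace H]
    (I : ModelWithCorners ℝ (EuclideanSpace ℝ (Fin n)) H)
    {M : Type*} [TopologicalSpace M] [ChartedSpace H M] [MeasurableSpace M]
    [RiemannianBundle (fun x : M ↦ TangentSpace I x)] (φ : M → ℝ) (u w : M → ℝ) : Prop :=
  MemLp w 2 (weightedVolume I φ) ∧
  ∃ X : (x : M) → TangentSpace I x, HasGradient I φ u X ∧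
    ∀ (v : M → ℝ) (Y : (x : M) → TangentSpace I x), HasGradient I φ v Y →
      ∫ x, inner ℝ (X x) (Y x) ∂weightedVolume I φ = ∫ x, w x * v x ∂weightedVolume I φ

/-- `μ` is an eigenvalue of the Bakry-Émery Laplacian (with the sign convention `-Δ_φ u = μ u`). -/
def IsEigenvalue {n : ℕ} {H : Type*} [TopologicalSpace H]
    (I : ModelWithCorners ℝ (EuclideanSpace ℝ (Fin n)) H)
    {M : Type*} [TopologicalSpace M] [ChartedSpace H M] [MeasurableSpace M]
    [RiemannianBundle (fun x : M ↦ TangentSpace I x)] (φ : M → ℝ) (μ : ℝ) : Prop :=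
  ∃ u : M → ℝ, ¬ u =ᵐ[weightedVolume I φ] 0 ∧ HasNegLaplacian I φ u (fun x ↦ μ * u x)

/-- The first nonzero eigenvalue `λ₁` of the Bakry-Émery Laplacian. -/
def firstEigenvalue {n : ℕ} {H : Type*} [TopologicalSpace H]
    (I : ModelWithCorners ℝ (EuclideanSpace ℝ (Fin n)) H)
    {M : Type*} [TopologicalSpace M] [ChartedSpace H M] [MeasurableSpace M]
    [RiemannianBundle (fun x : M ↦ TangentSpace I x)] (φ : M → ℝ) : ℝ :=
  sInf {μ : ℝ | μ ≠ 0 ∧ IsEigenvalue I φ μ}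

end Spectrum

end BakryEmery

end

noncomputable section

namespace BakryEmery

/-! ### Poincaré inequality on bounded convex sets of a finite-dimensional space. -/

section Convex

/-! Write a = ∫u², b = ∫|u|, c = ∫|u|^{2ν/(ν-2)}, D = ∫|∇u|², all against the weighted measure.
Hölder's inequality interpolates L² between L¹ and L^{2ν/(ν-2)}: a^{(2+ν)/ν} ≤ c^{(ν-2)/ν} b^{4/ν}.
The Sobolev inequality bounds the first factor by C₀ V^{-2/ν}(D + αa), and the Poincaré inequality
λ₁a ≤ D turns λ₁(D + αa) into at most (λ₁ + α)D. Rearranging gives the claim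
(`integral_sq_le_interpolation`, `nash_of_sobolev_of_poincare`). Testing the Sobolev inequality with
u = 1 shows that the weighted volume is finite and, when it is positive, that α > 0; so the
denominator λ₁ + α is positive whatever λ₁ is.

The substance is the Poincaré inequality with λ₁ defined as the infimum of the nonzero eigenvalues
of the form operator (`HasGradient.firstEigenvalue_mul_le`). It is proved by minimising the Rayleigh
quotient over smooth functions of mean zero. A minimising sequence has an L²-convergent subsequence
by Rellich's theorem, the parallelogram law makes its gradients Cauchy, and the limit lies in H¹ by
completeness. Its first variation is the weak eigenvalue equation, so the minimum is an eigenvalue.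
On a connected manifold it is nonzero, because a function with vanishing gradient is constant. Hence
λ₁ is at most the minimum, which is the direction needed.

Rellich's theorem comes from a quantitative estimate (`exists_integral_sq_le`): ∫f² is at most
ε∫|∇f|² plus a multiple of finitely many squared integrals (∫_A f)². It follows by cutting chart
balls into small convex cells and applying the Euclidean Poincaré inequality on each. A boundary
needs no separate treatment, since the range of the model with corners is convex and its
intersection with a ball or a cell stays convex. -/

lemma sq_lintegral_le {α : Type*} [MeasurableSpace α] {μ : Measure α} [IsProbabilityMeasure μ]
    {f : α → ℝ≥0∞} (hf : AEMeasurable f μ) : (∫⁻ a, f a ∂μ) ^ 2 ≤ ∫⁻ a, f a ^ 2 ∂μ := by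
  have h := ENNReal.lintegral_mul_le_Lp_mul_Lq μ Real.HolderConjugate.two_two hf
    (aemeasurable_const (b := (1 : ℝ≥0∞)))
  simp only [Pi.mul_apply, mul_one, ENNReal.one_rpow, lintegral_const, measure_univ] at h
  calc (∫⁻ a, f a ∂μ) ^ 2 ≤ ((∫⁻ a, f a ^ (2 : ℝ) ∂μ) ^ (1 / 2 : ℝ)) ^ 2 := by gcongr
    _ = ∫⁻ a, f a ^ 2 ∂μ := by
      rw [← ENNReal.rpow_natCast, ← ENNReal.rpow_mul]
      simp

variable {E : Type*} [NormedAddCommGroup E] [NormedSpace ℝ E]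

/-- The square of the increment of a function along a segment is at most the squared length times
the mean of the squared norm of the derivative. -/
lemma enorm_sub_sq_le_lintegral_segment {K : Set E} (hK : Convex ℝ K) {f : E → ℝ}
    {f' : E → E →L[ℝ] ℝ} (hf : ∀ x ∈ K, HasFDerivWithinAt f (f' x) K x)
    (hf' : ContinuousOn f' K) {x y : E} (hx : x ∈ K) (hy : y ∈ K) :
    ‖f y - f x‖ₑ ^ 2 ≤ ‖y - x‖ₑ ^ 2 *
      ∫⁻ t in Ioc (0 : ℝ) 1, ‖f' (AffineMap.lineMap x y t)‖ₑ ^ 2 := by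
  have hmaps : MapsTo (AffineMap.lineMap x y : ℝ → E) (Icc 0 1) K := fun t ht ↦
    hK.lineMap_mem hx hy ht
  have hline : Continuous (AffineMap.lineMap x y : ℝ → E) := AffineMap.lineMap_continuous
  have hd : ∀ t ∈ Icc (0 : ℝ) 1, HasDerivWithinAt (fun t : ℝ ↦ f (AffineMap.lineMap x y t))
      (f' (AffineMap.lineMap x y t) (y - x)) (Icc 0 1) t := fun t ht ↦
    (hf _ (hmaps ht)).comp_hasDerivWithinAt t
      (AffineMap.hasDerivWithinAt_lineMap (a := x) (b := y)) hmaps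
  have hcf' : ContinuousOn (fun t : ℝ ↦ f' (AffineMap.lineMap x y t)) (Icc 0 1) :=
    hf'.comp hline.continuousOn hmaps
  have hcd : ContinuousOn (fun t : ℝ ↦ f' (AffineMap.lineMap x y t) (y - x)) (Icc 0 1) :=
    hcf'.clm_apply continuousOn_const
  have hint : ∫ t in (0 : ℝ)..1, f' (AffineMap.lineMap x y t) (y - x) = f y - f x := by
    have := intervalIntegral.integral_eq_sub_of_hasDeriv_right (a := 0) (b := 1)
      (f := fun t : ℝ ↦ f (AffineMap.lineMap x y t))
      (f' := fun t : ℝ ↦ f' (AffineMap.lineMap x y t) (y - x))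
      (by rw [uIcc_of_le zero_le_one]; exact fun t ht ↦ (hd t ht).continuousWithinAt)
      (by
        intro t ht
        simp only [zero_le_one, min_eq_left, max_eq_right] at ht
        exact ((hd t (Ioo_subset_Icc_self ht)).hasDerivAt
          (Icc_mem_nhds ht.1 ht.2)).hasDerivWithinAt)
      (by
        apply ContinuousOn.intervalIntegrable
        rwa [uIcc_of_le zero_le_one])
    simpa using this
  have : IsProbabilityMeasure ((volume : Measure ℝ).restrict (Ioc 0 1)) := ⟨by simp⟩
  have hmeas : AEMeasurable (fun t : ℝ ↦ ‖f' (AffineMap.lineMap x y t)‖ₑ)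
      (volume.restrict (Ioc 0 1)) :=
    ((hcf'.mono Ioc_subset_Icc_self).enorm.aemeasurable measurableSet_Ioc)
  rw [← hint, intervalIntegral.integral_of_le zero_le_one]
  calc ‖∫ t in Ioc (0 : ℝ) 1, f' (AffineMap.lineMap x y t) (y - x)‖ₑ ^ 2
      ≤ (∫⁻ t in Ioc (0 : ℝ) 1, ‖f' (AffineMap.lineMap x y t) (y - x)‖ₑ) ^ 2 := by
        gcongr; exact enorm_integral_le_lintegral_enorm _
    _ ≤ (∫⁻ t in Ioc (0 : ℝ) 1, ‖y - x‖ₑ * ‖f' (AffineMap.lineMap x y t)‖ₑ) ^ 2 := by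
        gcongr with t
        rw [mul_comm]
        exact ContinuousLinearMap.le_opENorm _ _
    _ = ‖y - x‖ₑ ^ 2 * (∫⁻ t in Ioc (0 : ℝ) 1, ‖f' (AffineMap.lineMap x y t)‖ₑ) ^ 2 := by
        rw [lintegral_const_mul' _ _ enorm_ne_top, mul_pow]
    _ ≤ _ := by gcongr; exact sq_lintegral_le hmeas

variable [FiniteDimensional ℝ E] [MeasurableSpace E] [BorelSpace E] (μ : Measure E)
  [μ.IsAddHaarMeasure]

/-- The substitution has Jacobian t^{-dim}, which is at most 2^dim as long as t stays away from 0.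
-/
lemma lintegral_smul_add_le {G : E → ℝ≥0∞} (hG : Measurable G) {t : ℝ} (ht : 1 / 2 ≤ t) (a : E) :
    ∫⁻ y, G (a + t • y) ∂μ ≤ 2 ^ Module.finrank ℝ E * ∫⁻ y, G y ∂μ := by
  have ht0 : 0 < t := by linarith
  have h1 : ∫⁻ y, G (a + t • y) ∂μ = ∫⁻ y, G (a + y) ∂(Measure.map (fun x ↦ t • x) μ) := by
    rw [lintegral_map (by fun_prop) (by fun_prop)]
  rw [h1, Measure.map_addHaar_smul μ ht0.ne', lintegral_smul_measure,
    lintegral_add_left_eq_self (μ := μ) G a, smul_eq_mul]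
  gcongr
  rw [abs_of_nonneg (by positivity)]
  calc ENNReal.ofReal (t ^ Module.finrank ℝ E)⁻¹ ≤ ENNReal.ofReal (2 ^ Module.finrank ℝ E) := by
        apply ENNReal.ofReal_le_ofReal
        rw [← inv_pow]
        gcongr
        rw [inv_le_comm₀ ht0 (by norm_num)]
        linarith
    _ = _ := by rw [ENNReal.ofReal_pow (by norm_num)]; norm_num

/-- The Poincaré inequality on a convex set, in its two-point form. -/
lemma lintegral_lintegral_enorm_sub_sq_le {K : Set E} (hK : Convex ℝ K) (hKm : MeasurableSet K)
    {f : E → ℝ} {f' : E → E →L[ℝ] ℝ} (hf : ∀ x ∈ K, HasFDerivWithinAt f (f' x) K x)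
    (hf' : ContinuousOn f' K) {d : ℝ≥0∞} (hd : ∀ x ∈ K, ∀ y ∈ K, ‖y - x‖ₑ ≤ d) :
    ∫⁻ x in K, ∫⁻ y in K, ‖f y - f x‖ₑ ^ 2 ∂μ ∂μ ≤
      d ^ 2 * (2 ^ Module.finrank ℝ E * μ K * ∫⁻ y in K, ‖f' y‖ₑ ^ 2 ∂μ) := by
  classical
  -- Extending by zero lets the image of K under an affine map be replaced by the whole space, at no
  -- cost.
  set G : E → ℝ≥0∞ := K.indicator fun y ↦ ‖f' y‖ₑ ^ 2 with hGdef
  have hG : Measurable G := by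
    have : ContinuousOn (fun y ↦ ‖f' y‖ₑ ^ 2) K := by
      have := hf'.enorm
      fun_prop
    rw [hGdef, ← piecewise_eq_indicator]
    exact this.measurable_piecewise continuousOn_const hKm
  have hGint : ∫⁻ y, G y ∂μ = ∫⁻ y in K, ‖f' y‖ₑ ^ 2 ∂μ := lintegral_indicator hKm _
  have hGt : ∀ a : E, ∀ t : ℝ, 1 / 2 ≤ t →
      ∫⁻ y in K, G (a + t • y) ∂μ ≤ 2 ^ Module.finrank ℝ E * ∫⁻ y in K, ‖f' y‖ₑ ^ 2 ∂μ := by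
    intro a t ht
    rw [← hGint]
    exact (setLIntegral_le_lintegral _ _).trans (lintegral_smul_add_le μ hG ht a)
  have hcont : Continuous fun p : (E × E) × ℝ ↦ (AffineMap.lineMap p.1.1 p.1.2 p.2 : E) := by
    simp only [AffineMap.lineMap_apply_module]
    fun_prop
  have key : ∀ t ∈ Ioc (0 : ℝ) 1,
      ∫⁻ x in K, ∫⁻ y in K, G (AffineMap.lineMap x y t) ∂μ ∂μ ≤
        2 ^ Module.finrank ℝ E * μ K * ∫⁻ y in K, ‖f' y‖ₑ ^ 2 ∂μ := by
    intro t ht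
    have hbound : ∀ H : E → ℝ≥0∞,
        (∀ x, H x ≤ 2 ^ Module.finrank ℝ E * ∫⁻ y in K, ‖f' y‖ₑ ^ 2 ∂μ) →
        ∫⁻ x in K, H x ∂μ ≤ 2 ^ Module.finrank ℝ E * μ K * ∫⁻ y in K, ‖f' y‖ₑ ^ 2 ∂μ := by
      intro H hH
      calc ∫⁻ x in K, H x ∂μ
          ≤ ∫⁻ x in K, 2 ^ Module.finrank ℝ E * ∫⁻ y in K, ‖f' y‖ₑ ^ 2 ∂μ ∂μ :=
            lintegral_mono hH
        _ = _ := by rw [setLIntegral_const]; ring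
    -- In (1 - t)x + ty one endpoint has weight at least 1/2. Integrating in that endpoint first
    -- keeps the Jacobian bounded uniformly in t.
    rcases le_total (1 / 2) t with h | h
    · refine hbound _ fun x ↦ ?_
      simp only [AffineMap.lineMap_apply_module]
      exact hGt ((1 - t) • x) t h
    · rw [lintegral_lintegral_swap]
      · refine hbound _ fun y ↦ ?_
        simp only [AffineMap.lineMap_apply_module, add_comm _ (t • y)]
        exact hGt (t • y) (1 - t) (by linarith)
      · have : Continuous fun p : E × E ↦ (AffineMap.lineMap p.1 p.2 t : E) := by
          simp only [AffineMap.lineMap_apply_module]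
          fun_prop
        exact (hG.comp this.measurable).aemeasurable
  have hGK : ∀ x ∈ K, ∀ y ∈ K, ‖f y - f x‖ₑ ^ 2 ≤
      d ^ 2 * ∫⁻ t in Ioc (0 : ℝ) 1, G (AffineMap.lineMap x y t) := by
    intro x hx y hy
    refine (enorm_sub_sq_le_lintegral_segment hK hf hf' hx hy).trans ?_
    have : ∫⁻ t in Ioc (0 : ℝ) 1, ‖f' (AffineMap.lineMap x y t)‖ₑ ^ 2 =
        ∫⁻ t in Ioc (0 : ℝ) 1, G (AffineMap.lineMap x y t) := by
      refine setLIntegral_congr_fun measurableSet_Ioc fun t ht ↦ ?_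
      exact (indicator_of_mem (hK.lineMap_mem hx hy (Ioc_subset_Icc_self ht))
        (fun y ↦ ‖f' y‖ₑ ^ 2)).symm
    rw [this]
    gcongr
    exact hd x hx y hy
  calc ∫⁻ x in K, ∫⁻ y in K, ‖f y - f x‖ₑ ^ 2 ∂μ ∂μ
      ≤ ∫⁻ x in K, ∫⁻ y in K, d ^ 2 *
          (∫⁻ t in Ioc (0 : ℝ) 1, G (AffineMap.lineMap x y t)) ∂μ ∂μ :=
        setLIntegral_mono' hKm fun x hx ↦ setLIntegral_mono' hKm fun y hy ↦ hGK x hx y hy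
    _ = d ^ 2 * ∫⁻ t in Ioc (0 : ℝ) 1, ∫⁻ x in K, ∫⁻ y in K,
          G (AffineMap.lineMap x y t) ∂μ ∂μ := by
        have hm2 : ∀ x, Measurable fun q : E × ℝ ↦ G (AffineMap.lineMap x q.1 q.2) := fun x ↦
          hG.comp (hcont.comp
            (show Continuous fun q : E × ℝ ↦ ((x, q.1), q.2) by fun_prop)).measurable
        have hm3 : Measurable fun q : (E × ℝ) × E ↦ G (AffineMap.lineMap q.1.1 q.2 q.1.2) :=
          hG.comp (hcont.comp
            (show Continuous fun q : (E × ℝ) × E ↦ ((q.1.1, q.2), q.1.2) by fun_prop)).measurable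
        have hm4 : Measurable fun q : (E × E) × ℝ ↦ G (AffineMap.lineMap q.1.1 q.1.2 q.2) :=
          hG.comp hcont.measurable
        have e1 : ∀ x, ∫⁻ y in K, d ^ 2 *
            (∫⁻ t in Ioc (0 : ℝ) 1, G (AffineMap.lineMap x y t)) ∂μ =
            d ^ 2 * ∫⁻ t in Ioc (0 : ℝ) 1, ∫⁻ y in K, G (AffineMap.lineMap x y t) ∂μ := by
          intro x
          rw [lintegral_const_mul _ (Measurable.lintegral_prod_right' (hm2 x)),
            lintegral_lintegral_swap (hm2 x).aemeasurable]
        simp_rw [e1]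
        have hm5 : Measurable fun q : E × ℝ ↦ ∫⁻ y in K, G (AffineMap.lineMap q.1 y q.2) ∂μ :=
          Measurable.lintegral_prod_right' hm3
        rw [lintegral_const_mul _ (Measurable.lintegral_prod_right' hm5),
          lintegral_lintegral_swap hm5.aemeasurable]
    _ ≤ d ^ 2 * ∫⁻ t in Ioc (0 : ℝ) 1,
          2 ^ Module.finrank ℝ E * μ K * ∫⁻ y in K, ‖f' y‖ₑ ^ 2 ∂μ := by
        refine mul_le_mul_right ?_ _
        exact setLIntegral_mono' measurableSet_Ioc key
    _ = _ := by simp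

/-- The Poincaré inequality on a convex set. -/
lemma exists_lintegral_enorm_sub_sq_le {K : Set E} (hK : Convex ℝ K) (hKm : MeasurableSet K)
    {f : E → ℝ} {f' : E → E →L[ℝ] ℝ} (hf : ∀ x ∈ K, HasFDerivWithinAt f (f' x) K x)
    (hf' : ContinuousOn f' K) {d : ℝ≥0∞} (hd : ∀ x ∈ K, ∀ y ∈ K, ‖y - x‖ₑ ≤ d)
    (hKfin : μ K ≠ ⊤) :
    ∃ c : ℝ, ∫⁻ y in K, ‖f y - c‖ₑ ^ 2 ∂μ ≤
      d ^ 2 * 2 ^ Module.finrank ℝ E * ∫⁻ y in K, ‖f' y‖ₑ ^ 2 ∂μ := by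
  by_cases hK0 : μ K = 0
  · exact ⟨0, by rw [Measure.restrict_eq_zero.2 hK0]; simp⟩
  -- The constant is found by averaging: the two-point inequality bounds the mean over x of ∫|f y -
  -- f x|² by B, so c = f x cannot fail for every x.
  by_contra! hcon
  have hfc : ContinuousOn f K := fun x hx ↦ (hf x hx).continuousWithinAt
  set B := d ^ 2 * 2 ^ Module.finrank ℝ E * ∫⁻ y in K, ‖f' y‖ₑ ^ 2 ∂μ with hB
  have hle : ∫⁻ x in K, ∫⁻ y in K, ‖f y - f x‖ₑ ^ 2 ∂μ ∂μ ≤ ∫⁻ _ in K, B ∂μ := by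
    refine (lintegral_lintegral_enorm_sub_sq_le μ hK hKm hf hf' hd).trans (le_of_eq ?_)
    rw [setLIntegral_const, hB]
    ring
  have hBtop : B ≠ ⊤ := (hcon 0).ne_top
  have hfm : AEMeasurable f (μ.restrict K) := hfc.aemeasurable hKm
  have : Fact (μ K < ⊤) := ⟨hKfin.lt_top⟩
  have hm : AEMeasurable (fun x ↦ ∫⁻ y in K, ‖f y - f x‖ₑ ^ 2 ∂μ) (μ.restrict K) := by
    refine AEMeasurable.lintegral_prod_right'
      (f := fun p : E × E ↦ ‖f p.2 - f p.1‖ₑ ^ 2) (ν := μ.restrict K) ?_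
    exact (hfm.comp_snd.sub hfm.comp_fst).enorm.pow_const 2
  have hlt : ∫⁻ _ in K, B ∂μ < ∫⁻ x in K, ∫⁻ y in K, ‖f y - f x‖ₑ ^ 2 ∂μ ∂μ :=
    lintegral_strict_mono (by simpa using hK0) hm
      (by simpa using ENNReal.mul_ne_top hBtop hKfin) (ae_of_all _ fun x ↦ hcon (f x))
  exact absurd hle (not_le.2 hlt)

end Convex

/-! ### The metric and the volume density in a chart. -/

section Chart

variable {n : ℕ} {H : Type*} [TopologicalSpace H]
    {I : ModelWithCorners ℝ (EuclideanSpace ℝ (Fin n)) H}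
    {M : Type*} [TopologicalSpace M] [ChartedSpace H M]

section

variable [IsManifold I 1 M]

/-- The differential of the inverse of a chart within the chart target agrees with its
differential within the range of the model. -/
lemma mfderivWithin_target_extChartAt_symm {x₀ : M} {y : EuclideanSpace ℝ (Fin n)}
    (hy : y ∈ (extChartAt I x₀).target) :
    mfderivWithin 𝓘(ℝ, EuclideanSpace ℝ (Fin n)) I (extChartAt I x₀).symm
        (extChartAt I x₀).target y =
      mfderivWithin 𝓘(ℝ, EuclideanSpace ℝ (Fin n)) I (extChartAt I x₀).symm (range I) y :=
  ((mdifferentiableWithinAt_extChartAt_symm hy).hasMFDerivWithinAt.mono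
    (extChartAt_target_subset_range x₀)).mfderivWithin
    ((uniqueDiffOn_extChartAt_target x₀ y hy).uniqueMDiffWithinAt)

lemma linearIndependent_coordVector {x₀ : M} {y : EuclideanSpace ℝ (Fin n)}
    (hy : y ∈ (extChartAt I x₀).target) : LinearIndependent ℝ (coordVector I x₀ y) := by
  have hli : LinearIndependent ℝ
      (fun i : Fin n ↦ (EuclideanSpace.single i (1 : ℝ) : EuclideanSpace ℝ (Fin n))) := by
    have h : (fun i : Fin n ↦ (EuclideanSpace.single i (1 : ℝ) : EuclideanSpace ℝ (Fin n))) =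
        EuclideanSpace.basisFun (Fin n) ℝ := by
      ext1 i
      simp
    rw [h]
    exact (EuclideanSpace.basisFun (Fin n) ℝ).orthonormal.linearIndependent
  have hinv := isInvertible_mfderivWithin_extChartAt_symm (I := I) hy
  exact hli.map' (mfderivWithin 𝓘(ℝ, EuclideanSpace ℝ (Fin n)) I (extChartAt I x₀).symm
    (range I) y).toLinearMap (LinearMap.ker_eq_bot.2 hinv.injective)

/-- The coordinate field is the tangent map of the C¹ inverse chart applied to a constant vector.
The tangent map is taken within the chart target, where derivatives are unique even at boundary
points. -/
lemma contMDiffOn_coordVector (x₀ : M) (i : Fin n) :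
    ContMDiffOn 𝓘(ℝ, EuclideanSpace ℝ (Fin n)) I.tangent 0
      (fun y ↦ (⟨(extChartAt I x₀).symm y, coordVector I x₀ y i⟩ : TangentBundle I M))
      (extChartAt I x₀).target := by
  have h1 := (contMDiffOn_extChartAt_symm (I := I) (n := 1) x₀).contMDiffOn_tangentMapWithin
    (m := 0) (by norm_num) (uniqueDiffOn_extChartAt_target x₀).uniqueMDiffOn
  have h2 : ContMDiffOn 𝓘(ℝ, EuclideanSpace ℝ (Fin n)) 𝓘(ℝ, EuclideanSpace ℝ (Fin n)).tangent 0
      (fun y ↦ (⟨y, EuclideanSpace.single i (1 : ℝ)⟩ :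
        TangentBundle 𝓘(ℝ, EuclideanSpace ℝ (Fin n)) (EuclideanSpace ℝ (Fin n))))
      (extChartAt I x₀).target := by
    rw [contMDiffOn_zero_iff]
    have : Continuous ((tangentBundleModelSpaceHomeomorph
      𝓘(ℝ, EuclideanSpace ℝ (Fin n))).symm ∘ fun y ↦ (y, EuclideanSpace.single i (1 : ℝ))) :=
      (Homeomorph.continuous _).comp (by fun_prop)
    exact this.continuousOn
  refine (h1.comp h2 fun y hy ↦ hy).congr fun y hy ↦ ?_
  simp only [Function.comp_apply, tangentMapWithin, mfderivWithin_target_extChartAt_symm hy]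
  rfl

end

variable [RiemannianBundle (fun x : M ↦ TangentSpace I x)]

variable (I) in
/-- The matrix of the metric in a chart. -/
def chartGram (x₀ : M) (y : EuclideanSpace ℝ (Fin n)) : Matrix (Fin n) (Fin n) ℝ :=
  Matrix.of fun i j : Fin n ↦ inner ℝ (coordVector I x₀ y i) (coordVector I x₀ y j)

lemma volumeDensity_eq (x₀ : M) (y : EuclideanSpace ℝ (Fin n)) :
    volumeDensity I x₀ y = Real.sqrt (chartGram I x₀ y).det := rfl

section

variable [IsManifold I 1 M]

lemma chartGram_posDef {x₀ : M} {y : EuclideanSpace ℝ (Fin n)}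
    (hy : y ∈ (extChartAt I x₀).target) : (chartGram I x₀ y).PosDef :=
  Matrix.posDef_gram_of_linearIndependent (linearIndependent_coordVector hy)

lemma volumeDensity_pos {x₀ : M} {y : EuclideanSpace ℝ (Fin n)}
    (hy : y ∈ (extChartAt I x₀).target) : 0 < volumeDensity I x₀ y :=
  Real.sqrt_pos.2 (chartGram_posDef hy).det_pos

end

variable [IsManifold I 1 M]
  [IsContMDiffRiemannianBundle I 0 (EuclideanSpace ℝ (Fin n)) (fun x : M ↦ TangentSpace I x)]

lemma continuousOn_chartGram (x₀ : M) :
    ContinuousOn (chartGram I x₀) (extChartAt I x₀).target := by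
  refine continuousOn_pi.2 fun i ↦ continuousOn_pi.2 fun j ↦ ?_
  exact ((contMDiffOn_coordVector x₀ i).inner_bundle
    (IB := I) (F := EuclideanSpace ℝ (Fin n)) (E := fun x : M ↦ TangentSpace I x)
    (contMDiffOn_coordVector x₀ j)).continuousOn

lemma continuousOn_volumeDensity (x₀ : M) :
    ContinuousOn (volumeDensity I x₀) (extChartAt I x₀).target :=
  Real.continuous_sqrt.comp_continuousOn
    (Continuous.comp_continuousOn (Continuous.matrix_det continuous_id)
      (continuousOn_chartGram x₀))

end Chart

/-! ### Independence of the Riemannian volume from the chart. -/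

section ChangeOfChart

lemma measurableSet_inter_preimage_of_continuousOn {X Y : Type*} [TopologicalSpace X]
    [MeasurableSpace X] [BorelSpace X] [TopologicalSpace Y] [MeasurableSpace Y] [BorelSpace Y]
    {f : X → Y} {s : Set X} (hs : MeasurableSet s) (hf : ContinuousOn f s) {t : Set Y}
    (ht : MeasurableSet t) : MeasurableSet (s ∩ f ⁻¹' t) := by
  rw [← Subtype.image_preimage_coe]
  refine hs.subtype_image ?_
  exact (continuousOn_iff_continuous_domRestrict.1 hf).measurable ht

variable {n : ℕ} {H : Type*} [TopologicalSpace H]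
    {I : ModelWithCorners ℝ (EuclideanSpace ℝ (Fin n)) H}
    {M : Type*} [TopologicalSpace M] [ChartedSpace H M]

lemma measurableSet_extChartAt_target (x₀ : M) : MeasurableSet (extChartAt I x₀).target := by
  rw [extChartAt_target]
  exact ((chartAt H x₀).open_target.preimage I.continuous_symm).measurableSet.inter
    I.isClosed_range.measurableSet

lemma measurableSet_target_inter_preimage [MeasurableSpace M] [BorelSpace M] (x₀ : M) {A : Set M}
    (hA : MeasurableSet A) :
    MeasurableSet ((extChartAt I x₀).target ∩ (extChartAt I x₀).symm ⁻¹' A) :=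
  measurableSet_inter_preimage_of_continuousOn (measurableSet_extChartAt_target x₀)
    (continuousOn_extChartAt_symm x₀) hA

lemma aemeasurable_extChartAt_symm [MeasurableSpace M] [BorelSpace M] (x₀ : M)
    (g : EuclideanSpace ℝ (Fin n) → ℝ≥0∞) :
    AEMeasurable (extChartAt I x₀).symm
      ((volume.restrict (extChartAt I x₀).target).withDensity g) := by
  refine AEMeasurable.mono_ac ?_ (withDensity_absolutelyContinuous _ _)
  exact (continuousOn_extChartAt_symm x₀).aemeasurable (measurableSet_extChartAt_target x₀)

section

variable [RiemannianBundle (fun x : M ↦ TangentSpace I x)]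

lemma chartVolume_apply [MeasurableSpace M] [BorelSpace M] (x₀ : M)
    {A : Set M} (hA : MeasurableSet A) :
    chartVolume I x₀ A = ∫⁻ y in (extChartAt I x₀).target ∩ (extChartAt I x₀).symm ⁻¹' A,
      ENNReal.ofReal (volumeDensity I x₀ y) := by
  rw [chartVolume, Measure.map_apply_of_aemeasurable (aemeasurable_extChartAt_symm x₀ _) hA,
    withDensity_apply', Measure.restrict_restrict₀', inter_comm]
  exact (measurableSet_extChartAt_target x₀).nullMeasurableSet

lemma chartVolume_compl_source [MeasurableSpace M] [BorelSpace M] (x₀ : M) :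
    chartVolume I x₀ (extChartAt I x₀).sourceᶜ = 0 := by
  rw [chartVolume_apply x₀ (isOpen_extChartAt_source x₀).measurableSet.compl]
  have : (extChartAt I x₀).target ∩ (extChartAt I x₀).symm ⁻¹' (extChartAt I x₀).sourceᶜ = ∅ := by
    ext y
    simp only [mem_inter_iff, mem_preimage, mem_compl_iff, mem_empty_iff_false, iff_false, not_and,
      not_not]
    exact (extChartAt I x₀).map_target
  rw [this, Measure.restrict_empty, lintegral_zero_measure]

variable (I) in
/-- The metric at a point, read in the model vector space. -/
def metricAt (x : M) (v w : EuclideanSpace ℝ (Fin n)) : ℝ :=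
  inner ℝ (show TangentSpace I x from v) (show TangentSpace I x from w)

variable (I) in
/-- The differential of the inverse of the chart at `x₀`. -/
def chartFrame (x₀ : M) (y : EuclideanSpace ℝ (Fin n)) :
    EuclideanSpace ℝ (Fin n) →L[ℝ] EuclideanSpace ℝ (Fin n) :=
  mfderivWithin 𝓘(ℝ, EuclideanSpace ℝ (Fin n)) I (extChartAt I x₀).symm (range I) y

lemma chartGram_apply (x₀ : M) (y : EuclideanSpace ℝ (Fin n)) (i j : Fin n) :
    chartGram I x₀ y i j = metricAt I ((extChartAt I x₀).symm y)
      (chartFrame I x₀ y (EuclideanSpace.single i 1))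
      (chartFrame I x₀ y (EuclideanSpace.single j 1)) := rfl

/-- Bilinearity of the metric, phrased in the fixed model space so that equal base points coming
from two charts can be rewritten without transporting tangent vectors. -/
lemma metricAt_sum_sum (x : M) {ι : Type*} (s : Finset ι) (a b : ι → ℝ)
    (v w : ι → EuclideanSpace ℝ (Fin n)) :
    metricAt I x (∑ i ∈ s, a i • v i) (∑ j ∈ s, b j • w j) =
      ∑ i ∈ s, ∑ j ∈ s, a i * (b j * metricAt I x (v i) (w j)) := by
  have := sum_inner (𝕜 := ℝ) s (fun i ↦ (show TangentSpace I x from a i • v i))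
    (show TangentSpace I x from ∑ j ∈ s, b j • w j)
  refine this.trans (Finset.sum_congr rfl fun i _ ↦ ?_)
  refine (inner_sum (𝕜 := ℝ) s (fun j ↦ (show TangentSpace I x from b j • w j))
    (show TangentSpace I x from a i • v i)).trans (Finset.sum_congr rfl fun j _ ↦ ?_)
  refine (real_inner_smul_left (F := TangentSpace I x) _ _ _).trans ?_
  congr 1
  exact real_inner_smul_right (F := TangentSpace I x) _ _ _

end

variable (I) in
/-- The differential of the transition map from the chart at `x₀` to the chart at `x₁`. -/
def transitionDeriv (x₀ x₁ : M) (y : EuclideanSpace ℝ (Fin n)) :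
    EuclideanSpace ℝ (Fin n) →L[ℝ] EuclideanSpace ℝ (Fin n) :=
  ContinuousLinearMap.comp
    (show EuclideanSpace ℝ (Fin n) →L[ℝ] EuclideanSpace ℝ (Fin n) from
      mfderiv I 𝓘(ℝ, EuclideanSpace ℝ (Fin n)) (extChartAt I x₁) ((extChartAt I x₀).symm y))
    (chartFrame I x₀ y)

variable [IsManifold I 1 M]

lemma hasFDerivWithinAt_transition {x₀ x₁ : M} {y : EuclideanSpace ℝ (Fin n)}
    (hy : y ∈ (extChartAt I x₀).target)
    (hy₁ : (extChartAt I x₀).symm y ∈ (extChartAt I x₁).source) :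
    HasFDerivWithinAt (extChartAt I x₁ ∘ (extChartAt I x₀).symm)
      (transitionDeriv I x₀ x₁ y) (range I) y := by
  rw [extChartAt_source] at hy₁
  refine HasMFDerivWithinAt.hasFDerivWithinAt ?_
  exact (mdifferentiableAt_extChartAt hy₁).hasMFDerivAt.comp_hasMFDerivWithinAt y
    (mdifferentiableWithinAt_extChartAt_symm hy).hasMFDerivWithinAt

lemma chartFrame_transition {x₀ x₁ : M} {y : EuclideanSpace ℝ (Fin n)}
    (hy₁ : (extChartAt I x₀).symm y ∈ (extChartAt I x₁).source) (v : EuclideanSpace ℝ (Fin n)) :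
    chartFrame I x₁ (extChartAt I x₁ ((extChartAt I x₀).symm y)) (transitionDeriv I x₀ x₁ y v) =
      chartFrame I x₀ y v := by
  have h := mfderivWithin_extChartAt_symm_comp_mfderiv_extChartAt' (I := I) hy₁
  exact congrArg (fun L : EuclideanSpace ℝ (Fin n) →L[ℝ] EuclideanSpace ℝ (Fin n) ↦
    L (chartFrame I x₀ y v)) h

variable [RiemannianBundle (fun x : M ↦ TangentSpace I x)]

/-- If T is the matrix of the transition differential, the Gram matrices satisfy G₀ = Tᵀ G₁ T, so
the roots of their determinants differ by |det T|. -/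
lemma volumeDensity_transition {x₀ x₁ : M} {y : EuclideanSpace ℝ (Fin n)}
    (hy₁ : (extChartAt I x₀).symm y ∈ (extChartAt I x₁).source) :
    |(transitionDeriv I x₀ x₁ y).det| *
      volumeDensity I x₁ (extChartAt I x₁ ((extChartAt I x₀).symm y)) = volumeDensity I x₀ y := by
  set z := extChartAt I x₁ ((extChartAt I x₀).symm y) with hz
  have hzs : (extChartAt I x₁).symm z = (extChartAt I x₀).symm y :=
    (extChartAt I x₁).left_inv hy₁
  set b := (EuclideanSpace.basisFun (Fin n) ℝ).toBasis with hb
  set T := LinearMap.toMatrix b b (transitionDeriv I x₀ x₁ y : _ →ₗ[ℝ] _) with hT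
  have hframe : ∀ i, chartFrame I x₀ y (EuclideanSpace.single i 1) =
      ∑ k, T k i • chartFrame I x₁ z (EuclideanSpace.single k 1) := by
    intro i
    rw [← chartFrame_transition hy₁, ← hz]
    have : transitionDeriv I x₀ x₁ y (EuclideanSpace.single i 1) =
        ∑ k, T k i • (EuclideanSpace.single k (1 : ℝ) : EuclideanSpace ℝ (Fin n)) := by
      rw [← b.sum_repr (transitionDeriv I x₀ x₁ y (EuclideanSpace.single i 1))]
      refine Finset.sum_congr rfl fun k _ ↦ ?_
      rw [hT, LinearMap.toMatrix_apply]
      simp [hb]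
    rw [this, map_sum]
    simp
  have hG : chartGram I x₀ y = T.transpose * chartGram I x₁ z * T := by
    ext i j
    rw [chartGram_apply, hframe i, hframe j, metricAt_sum_sum, Matrix.mul_apply]
    simp only [Matrix.mul_apply, Matrix.transpose_apply, chartGram_apply, hzs, Finset.sum_mul]
    rw [Finset.sum_comm]
    refine Finset.sum_congr rfl fun k _ ↦ Finset.sum_congr rfl fun l _ ↦ ?_
    ring
  rw [volumeDensity_eq, volumeDensity_eq, hG, Matrix.det_mul, Matrix.det_mul,
    Matrix.det_transpose, show (transitionDeriv I x₀ x₁ y).det = T.det from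
      (LinearMap.det_toMatrix b _).symm]
  rw [show T.det * (chartGram I x₁ z).det * T.det = T.det ^ 2 * (chartGram I x₁ z).det by ring,
    Real.sqrt_mul (sq_nonneg _), Real.sqrt_sq_eq_abs]

variable [MeasurableSpace M] [BorelSpace M]

/-- The Riemannian measures of two charts agree on the overlap. -/
lemma chartVolume_eq_of_subset {x₀ x₁ : M} {A : Set M} (hA : MeasurableSet A)
    (h₀ : A ⊆ (extChartAt I x₀).source) (h₁ : A ⊆ (extChartAt I x₁).source) :
    chartVolume I x₁ A = chartVolume I x₀ A := by
  rw [chartVolume_apply x₀ hA, chartVolume_apply x₁ hA]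
  set s := (extChartAt I x₀).target ∩ (extChartAt I x₀).symm ⁻¹' A with hs
  have himage : (extChartAt I x₁).target ∩ (extChartAt I x₁).symm ⁻¹' A =
      (extChartAt I x₁ ∘ (extChartAt I x₀).symm) '' s := by
    have h : (extChartAt I x₀).symm '' s = A := by
      ext x
      constructor
      · rintro ⟨y, hy, rfl⟩
        exact hy.2
      · intro hx
        have hl := (extChartAt I x₀).left_inv (h₀ hx)
        exact ⟨extChartAt I x₀ x, ⟨(extChartAt I x₀).map_source (h₀ hx),
          by rwa [mem_preimage, hl]⟩, hl⟩
    rw [image_comp, h]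
    ext y
    constructor
    · rintro ⟨hy, hyA⟩
      exact ⟨_, hyA, (extChartAt I x₁).right_inv hy⟩
    · rintro ⟨x, hx, rfl⟩
      exact ⟨(extChartAt I x₁).map_source (h₁ hx),
        by rwa [mem_preimage, (extChartAt I x₁).left_inv (h₁ hx)]⟩
  have hderiv : ∀ y ∈ s, HasFDerivWithinAt (extChartAt I x₁ ∘ (extChartAt I x₀).symm)
      (transitionDeriv I x₀ x₁ y) s y := fun y hy ↦
    (hasFDerivWithinAt_transition hy.1 (h₁ hy.2)).mono
      (inter_subset_left.trans (extChartAt_target_subset_range x₀))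
  have hinj : InjOn (extChartAt I x₁ ∘ (extChartAt I x₀).symm) s :=
    (extChartAt I x₁).injOn.comp ((extChartAt I x₀).symm.injOn.mono inter_subset_left)
      fun y hy ↦ h₁ hy.2
  rw [himage, lintegral_image_eq_lintegral_abs_det_fderiv_mul volume
    (measurableSet_target_inter_preimage x₀ hA) hderiv hinj]
  refine setLIntegral_congr_fun (measurableSet_target_inter_preimage x₀ hA) fun y hy ↦ ?_
  rw [← ENNReal.ofReal_mul (abs_nonneg _), Function.comp_apply, volumeDensity_transition (h₁ hy.2)]

/-- Only the upper bound on the supremum needs work. The chart measure at `x₀`, plus the Riemannian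
volume restricted to the complement of its source, dominates every chart measure: inside the source
this is agreement on overlaps, outside it is the definition of the supremum. -/
lemma riemannianVolume_restrict_source (x₀ : M) :
    (riemannianVolume I M).restrict (extChartAt I x₀).source = chartVolume I x₀ := by
  have hS : MeasurableSet (extChartAt I x₀).source := (isOpen_extChartAt_source x₀).measurableSet
  have hself : ∀ x₁ : M, (chartVolume I x₁).restrict (extChartAt I x₁).source =
      chartVolume I x₁ := fun x₁ ↦ by
    rw [Measure.restrict_eq_self_of_ae_mem]
    exact chartVolume_compl_source x₁
  apply le_antisymm
  · have hle : riemannianVolume I M ≤ chartVolume I x₀ +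
        (riemannianVolume I M).restrict (extChartAt I x₀).sourceᶜ := by
      refine iSup_le fun x₁ ↦ ?_
      rw [← Measure.restrict_add_restrict_compl (μ := chartVolume I x₁) hS]
      gcongr
      · rw [← hself x₁, Measure.restrict_restrict hS, Measure.le_iff]
        intro A hA
        rw [Measure.restrict_apply hA, chartVolume_eq_of_subset (x₀ := x₀)]
        · exact measure_mono inter_subset_left
        · exact hA.inter (hS.inter (isOpen_extChartAt_source x₁).measurableSet)
        · exact fun x hx ↦ hx.2.1
        · exact fun x hx ↦ hx.2.2
      · exact le_iSup (fun x : M ↦ chartVolume I x) x₁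
    calc (riemannianVolume I M).restrict (extChartAt I x₀).source
        ≤ (chartVolume I x₀ + (riemannianVolume I M).restrict
            (extChartAt I x₀).sourceᶜ).restrict (extChartAt I x₀).source :=
          Measure.restrict_mono subset_rfl hle
      _ = chartVolume I x₀ := by
          rw [Measure.restrict_add, hself, Measure.restrict_restrict hS, inter_compl_self,
            Measure.restrict_empty, add_zero]
  · rw [← hself x₀]
    exact Measure.restrict_mono subset_rfl (le_iSup (fun x : M ↦ chartVolume I x) x₀)

end ChangeOfChart

/-! ### The Riemannian gradient and its coordinate expression. -/

section Gradient

variable {n : ℕ} {H : Type*} [TopologicalSpace H]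
    {I : ModelWithCorners ℝ (EuclideanSpace ℝ (Fin n)) H}
    {M : Type*} [TopologicalSpace M] [ChartedSpace H M]

section

variable [RiemannianBundle (fun x : M ↦ TangentSpace I x)]

lemma inner_gradient (f : M → ℝ) (x : M) (v : TangentSpace I x) :
    inner ℝ (gradient I f x) v = mfderiv I 𝓘(ℝ, ℝ) f x v := by
  have : FiniteDimensional ℝ (TangentSpace I x) :=
    inferInstanceAs (FiniteDimensional ℝ (EuclideanSpace ℝ (Fin n)))
  have : CompleteSpace (TangentSpace I x) := FiniteDimensional.complete ℝ _
  exact InnerProductSpace.toDual_symm_apply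

lemma gradient_eq_of_forall {f : M → ℝ} {x : M} {w : TangentSpace I x}
    (h : ∀ v : TangentSpace I x, inner ℝ w v = mfderiv I 𝓘(ℝ, ℝ) f x v) :
    gradient I f x = w :=
  ext_inner_right ℝ fun v ↦ (inner_gradient f x v).trans (h v).symm

lemma gradient_add {f g : M → ℝ} (hf : MDifferentiable I 𝓘(ℝ, ℝ) f)
    (hg : MDifferentiable I 𝓘(ℝ, ℝ) g) (x : M) :
    gradient I (fun x ↦ f x + g x) x = gradient I f x + gradient I g x := by
  refine gradient_eq_of_forall fun v ↦ ?_
  rw [inner_add_left, inner_gradient, inner_gradient]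
  exact (congrArg (fun L : TangentSpace I x →L[ℝ] ℝ ↦ L v)
    ((hf x).hasMFDerivAt.add (hg x).hasMFDerivAt).mfderiv).symm

lemma gradient_const_mul (c : ℝ) {f : M → ℝ} (hf : MDifferentiable I 𝓘(ℝ, ℝ) f) (x : M) :
    gradient I (fun x ↦ c * f x) x = c • gradient I f x := by
  refine gradient_eq_of_forall fun v ↦ ?_
  rw [real_inner_smul_left, inner_gradient]
  exact (congrArg (fun L : TangentSpace I x →L[ℝ] ℝ ↦ L v)
    ((hf x).hasMFDerivAt.const_smul c).mfderiv).symm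

lemma gradient_const (c : ℝ) (x : M) : gradient I (fun _ : M ↦ c) x = 0 := by
  refine gradient_eq_of_forall fun v ↦ ?_
  rw [inner_zero_left, mfderiv_const]
  rfl

lemma gradient_sub {f g : M → ℝ} (hf : MDifferentiable I 𝓘(ℝ, ℝ) f)
    (hg : MDifferentiable I 𝓘(ℝ, ℝ) g) (x : M) :
    gradient I (fun x ↦ f x - g x) x = gradient I f x - gradient I g x := by
  refine gradient_eq_of_forall fun v ↦ ?_
  rw [inner_sub_left, inner_gradient, inner_gradient]
  exact (congrArg (fun L : TangentSpace I x →L[ℝ] ℝ ↦ L v)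
    ((hf x).hasMFDerivAt.sub (hg x).hasMFDerivAt).mfderiv).symm

end

variable (I) in
/-- The differential of a function, read in the chart at `x₀`. -/
def chartDeriv (x₀ : M) (f : M → ℝ) (y : EuclideanSpace ℝ (Fin n)) :
    EuclideanSpace ℝ (Fin n) →L[ℝ] ℝ :=
  ContinuousLinearMap.comp
    (show EuclideanSpace ℝ (Fin n) →L[ℝ] ℝ from
      mfderiv I 𝓘(ℝ, ℝ) f ((extChartAt I x₀).symm y)) (chartFrame I x₀ y)

lemma chartDeriv_single [RiemannianBundle (fun x : M ↦ TangentSpace I x)]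
    (x₀ : M) (f : M → ℝ) (y : EuclideanSpace ℝ (Fin n)) (i : Fin n) :
    chartDeriv I x₀ f y (EuclideanSpace.single i 1) =
      inner ℝ (gradient I f ((extChartAt I x₀).symm y)) (coordVector I x₀ y i) :=
  (inner_gradient f _ (coordVector I x₀ y i)).symm

/-- Cauchy-Schwarz against each coordinate vector, whose Riemannian length is √gᵢᵢ. The constant is
crude, but it is bounded on compact subsets of the chart target. -/
lemma norm_chartDeriv_le [RiemannianBundle (fun x : M ↦ TangentSpace I x)]
    (x₀ : M) (y : EuclideanSpace ℝ (Fin n)) (f : M → ℝ) :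
    ‖chartDeriv I x₀ f y‖ ≤ (∑ i, Real.sqrt (chartGram I x₀ y i i)) *
      ‖gradient I f ((extChartAt I x₀).symm y)‖ := by
  refine ContinuousLinearMap.opNorm_le_bound _
    (mul_nonneg (Finset.sum_nonneg fun i _ ↦ Real.sqrt_nonneg _) (norm_nonneg _)) fun v ↦ ?_
  have hv : v = ∑ i, v i • (EuclideanSpace.single i (1 : ℝ) : EuclideanSpace ℝ (Fin n)) := by
    have := (EuclideanSpace.basisFun (Fin n) ℝ).sum_repr v
    simpa using this.symm
  conv_lhs => rw [hv]
  rw [map_sum, Finset.sum_mul, Finset.sum_mul]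
  refine (norm_sum_le _ _).trans (Finset.sum_le_sum fun i _ ↦ ?_)
  have h1 : ‖v i‖ ≤ ‖v‖ := PiLp.norm_apply_le v i
  have h2 : Real.sqrt (chartGram I x₀ y i i) = ‖coordVector I x₀ y i‖ :=
    (norm_eq_sqrt_real_inner (F := TangentSpace I ((extChartAt I x₀).symm y)) _).symm
  have h3 := norm_inner_le_norm (𝕜 := ℝ) (gradient I f ((extChartAt I x₀).symm y))
    (coordVector I x₀ y i)
  rw [map_smul, chartDeriv_single, norm_smul, h2]
  calc ‖v i‖ * ‖inner ℝ (gradient I f ((extChartAt I x₀).symm y)) (coordVector I x₀ y i)‖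
      ≤ ‖v‖ * (‖gradient I f ((extChartAt I x₀).symm y)‖ * ‖coordVector I x₀ y i‖) :=
        mul_le_mul h1 h3 (norm_nonneg _) (norm_nonneg _)
    _ = _ := by ring

variable [IsManifold I 1 M]

lemma hasFDerivWithinAt_chartDeriv {f : M → ℝ} (hf : ContMDiff I 𝓘(ℝ, ℝ) 1 f) {x₀ : M}
    {y : EuclideanSpace ℝ (Fin n)} (hy : y ∈ (extChartAt I x₀).target) :
    HasFDerivWithinAt (f ∘ (extChartAt I x₀).symm) (chartDeriv I x₀ f y)
      (extChartAt I x₀).target y := by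
  refine HasFDerivWithinAt.mono (HasMFDerivWithinAt.hasFDerivWithinAt ?_)
    (extChartAt_target_subset_range x₀)
  exact ((hf.mdifferentiable (by norm_num)) _).hasMFDerivAt.comp_hasMFDerivWithinAt y
    (mdifferentiableWithinAt_extChartAt_symm hy).hasMFDerivWithinAt

lemma continuousOn_chartDeriv {f : M → ℝ} (hf : ContMDiff I 𝓘(ℝ, ℝ) 1 f) (x₀ : M) :
    ContinuousOn (chartDeriv I x₀ f) (extChartAt I x₀).target := by
  have h1 : ContDiffOn ℝ 1 (f ∘ (extChartAt I x₀).symm) (extChartAt I x₀).target :=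
    contMDiffOn_iff_contDiffOn.1
      (hf.comp_contMDiffOn (contMDiffOn_extChartAt_symm (I := I) (n := 1) x₀))
  refine (h1.continuousOn_fderivWithin (uniqueDiffOn_extChartAt_target x₀) le_rfl).congr
    fun y hy ↦ ?_
  exact ((hasFDerivWithinAt_chartDeriv hf hy).fderivWithin
    (uniqueDiffOn_extChartAt_target x₀ y hy)).symm

variable [RiemannianBundle (fun x : M ↦ TangentSpace I x)]

/-- The coordinate expression `g^{ij} ∂ᵢf ∂ⱼf` of the squared norm of the gradient. -/
lemma norm_gradient_sq_eq {x₀ : M} {y : EuclideanSpace ℝ (Fin n)}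
    (hy : y ∈ (extChartAt I x₀).target) (f : M → ℝ) :
    ‖gradient I f ((extChartAt I x₀).symm y)‖ ^ 2 =
      (fun i ↦ chartDeriv I x₀ f y (EuclideanSpace.single i 1)) ⬝ᵥ
        ((chartGram I x₀ y)⁻¹.mulVec
          fun i ↦ chartDeriv I x₀ f y (EuclideanSpace.single i 1)) := by
  have : FiniteDimensional ℝ (TangentSpace I ((extChartAt I x₀).symm y)) :=
    inferInstanceAs (FiniteDimensional ℝ (EuclideanSpace ℝ (Fin n)))
  have hcard : Fintype.card (Fin n) =
      Module.finrank ℝ (TangentSpace I ((extChartAt I x₀).symm y)) := by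
    rw [show Module.finrank ℝ (TangentSpace I ((extChartAt I x₀).symm y)) =
      Module.finrank ℝ (EuclideanSpace ℝ (Fin n)) from rfl]
    simp
  let b := basisOfLinearIndependentOfCardEqFinrank' (coordVector I x₀ y)
    (linearIndependent_coordVector hy) hcard
  have hb : ∀ i, b i = coordVector I x₀ y i := fun i ↦
    congrFun (coe_basisOfLinearIndependentOfCardEqFinrank' _
      (linearIndependent_coordVector hy) hcard) i
  set G := chartGram I x₀ y
  set β : Fin n → ℝ := fun i ↦ chartDeriv I x₀ f y (EuclideanSpace.single i 1) with hβ
  set X := gradient I f ((extChartAt I x₀).symm y)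
  have hX : X = ∑ j, b.repr X j • coordVector I x₀ y j := by
    conv_lhs => rw [← b.sum_repr X]
    simp only [hb]
  set a : Fin n → ℝ := fun j ↦ b.repr X j with ha
  -- Pairing X = ∑ aʲ∂ⱼ with ∂ᵢ gives β = Ga, hence a = G⁻¹β and |X|² = β · G⁻¹β.
  have hβa : β = G.mulVec a := by
    ext i
    rw [hβ]
    simp only [chartDeriv_single]
    rw [show gradient I f ((extChartAt I x₀).symm y) = X from rfl, real_inner_comm, hX, inner_sum]
    simp only [real_inner_smul_right]
    simp only [Matrix.mulVec, dotProduct]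
    refine Finset.sum_congr rfl fun j _ ↦ ?_
    rw [mul_comm]
    rfl
  have haβ : G⁻¹.mulVec β = a := by
    rw [hβa, Matrix.mulVec_mulVec, Matrix.nonsing_inv_mul _
      (isUnit_iff_ne_zero.2 (chartGram_posDef hy).det_pos.ne'), Matrix.one_mulVec]
  rw [haβ, ← real_inner_self_eq_norm_sq]
  refine (congrArg (inner ℝ X) hX).trans ?_
  rw [inner_sum]
  simp only [real_inner_smul_right, dotProduct]
  refine Finset.sum_congr rfl fun j _ ↦ ?_
  rw [hβ]
  simp only [chartDeriv_single]
  ring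

variable [IsContMDiffRiemannianBundle I 0 (EuclideanSpace ℝ (Fin n))
  (fun x : M ↦ TangentSpace I x)]

/-- Continuity is read from g^{ij}∂ᵢf∂ⱼf, the inverse Gram matrix being continuous because its
determinant does not vanish. The gradient is never treated as a section of the tangent bundle; later
arguments use only its norm. -/
lemma continuous_norm_gradient {f : M → ℝ} (hf : ContMDiff I 𝓘(ℝ, ℝ) 1 f) :
    Continuous fun x ↦ ‖gradient I f x‖ := by
  have hsq : Continuous fun x ↦ ‖gradient I f x‖ ^ 2 := by
    rw [continuous_iff_continuousAt]
    intro x₀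
    have hβ : ∀ i, ContinuousOn (fun y ↦ chartDeriv I x₀ f y (EuclideanSpace.single i 1))
        (extChartAt I x₀).target := fun i ↦
      (continuousOn_chartDeriv hf x₀).clm_apply continuousOn_const
    have hG := continuousOn_chartGram (I := I) x₀
    have hinv : ContinuousOn (fun y ↦ (chartGram I x₀ y)⁻¹) (extChartAt I x₀).target := by
      simp only [Matrix.inv_def, Ring.inverse_eq_inv']
      refine ContinuousOn.smul
        (ContinuousOn.inv₀ ?_ fun y hy ↦ (chartGram_posDef hy).det_pos.ne') ?_
      · exact (Continuous.matrix_det continuous_id).comp_continuousOn hG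
      · exact (Continuous.matrix_adjugate continuous_id).comp_continuousOn hG
    have hc : ContinuousOn (fun y ↦ ‖gradient I f ((extChartAt I x₀).symm y)‖ ^ 2)
        (extChartAt I x₀).target := by
      refine ContinuousOn.congr ?_ fun y hy ↦ norm_gradient_sq_eq hy f
      simp only [dotProduct, Matrix.mulVec]
      refine continuousOn_finsetSum _ fun i _ ↦ (hβ i).mul
        (continuousOn_finsetSum _ fun j _ ↦ ContinuousOn.mul ?_ (hβ j))
      exact (continuous_apply_apply i j).comp_continuousOn hinv
    have h2 : ContinuousOn (fun x ↦ ‖gradient I f x‖ ^ 2) (extChartAt I x₀).source :=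
      (hc.comp (continuousOn_extChartAt x₀) (extChartAt I x₀).mapsTo).congr fun x hx ↦
        congrArg (fun z ↦ ‖gradient I f z‖ ^ 2) ((extChartAt I x₀).left_inv hx).symm
    exact h2.continuousAt (extChartAt_source_mem_nhds x₀)
  have : (fun x ↦ ‖gradient I f x‖) = fun x ↦ Real.sqrt (‖gradient I f x‖ ^ 2) := by
    ext x
    rw [Real.sqrt_sq (norm_nonneg _)]
  rw [this]
  exact hsq.sqrt

end Gradient

/-! ### Weighted integrals in a chart and the local Poincaré inequality. -/

section ChartIntegral

variable {n : ℕ} {H : Type*} [TopologicalSpace H]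
    {I : ModelWithCorners ℝ (EuclideanSpace ℝ (Fin n)) H}
    {M : Type*} [TopologicalSpace M] [ChartedSpace H M]

lemma measurableSet_source_inter_preimage [MeasurableSpace M] [BorelSpace M] (x₀ : M)
    {K : Set (EuclideanSpace ℝ (Fin n))} (hK : MeasurableSet K) :
    MeasurableSet ((extChartAt I x₀).source ∩ extChartAt I x₀ ⁻¹' K) :=
  measurableSet_inter_preimage_of_continuousOn (isOpen_extChartAt_source x₀).measurableSet
    (continuousOn_extChartAt x₀) hK

lemma ball_mem_nhds {x₀ : M} {r : ℝ} (hr : 0 < r) :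
    (extChartAt I x₀).source ∩ extChartAt I x₀ ⁻¹'
      (Metric.closedBall (extChartAt I x₀ x₀) r ∩ range I) ∈ 𝓝 x₀ := by
  filter_upwards [extChartAt_source_mem_nhds (I := I) x₀,
    (continuousAt_extChartAt (I := I) x₀) (Metric.closedBall_mem_nhds _ hr)] with x hx hx'
  exact ⟨hx, hx', extChartAt_target_subset_range x₀ ((extChartAt I x₀).map_source hx)⟩

variable [IsManifold I 1 M] [RiemannianBundle (fun x : M ↦ TangentSpace I x)]
  [IsContMDiffRiemannianBundle I 0 (EuclideanSpace ℝ (Fin n)) (fun x : M ↦ TangentSpace I x)]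

/-- Around each point, a closed ball of the chart on which the metric and the weighted volume
density are comparable to the Euclidean ones. -/
lemma exists_comparison_ball {φ : M → ℝ} (hφ : Continuous φ) (x₀ : M) :
    ∃ r > 0, ∃ a > 0, ∃ b : ℝ, ∃ B : ℝ,
      Metric.closedBall (extChartAt I x₀ x₀) r ∩ range I ⊆ (extChartAt I x₀).target ∧
      ∀ y ∈ Metric.closedBall (extChartAt I x₀ x₀) r ∩ range I,
        a ≤ volumeDensity I x₀ y * Real.exp (-φ ((extChartAt I x₀).symm y)) ∧
        volumeDensity I x₀ y * Real.exp (-φ ((extChartAt I x₀).symm y)) ≤ b ∧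
        ∑ i, Real.sqrt (chartGram I x₀ y i i) ≤ B := by
  obtain ⟨r, hr, hrt⟩ : ∃ r > 0,
      Metric.closedBall (extChartAt I x₀ x₀) r ∩ range I ⊆ (extChartAt I x₀).target := by
    obtain ⟨s, hs, hst⟩ := mem_nhdsWithin_iff_exists_mem_nhds_inter.1
      (extChartAt_target_mem_nhdsWithin (I := I) x₀)
    obtain ⟨r, hr, hrs⟩ := Metric.nhds_basis_closedBall.mem_iff.1 hs
    exact ⟨r, hr, (inter_subset_inter_left _ hrs).trans hst⟩
  set D := Metric.closedBall (extChartAt I x₀ x₀) r ∩ range I with hD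
  have hDc : IsCompact D := (isCompact_closedBall _ _).inter_right I.isClosed_range
  have hDne : D.Nonempty := ⟨extChartAt I x₀ x₀, Metric.mem_closedBall_self hr.le,
    extChartAt_target_subset_range x₀ (mem_extChartAt_target x₀)⟩
  have hw : ContinuousOn (fun y ↦ volumeDensity I x₀ y *
      Real.exp (-φ ((extChartAt I x₀).symm y))) D :=
    ((continuousOn_volumeDensity x₀).mul (Real.continuous_exp.comp_continuousOn
      (hφ.comp_continuousOn (continuousOn_extChartAt_symm x₀)).neg)).mono hrt
  have hB : ContinuousOn (fun y ↦ ∑ i, Real.sqrt (chartGram I x₀ y i i)) D := by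
    refine continuousOn_finsetSum _ fun i _ ↦ ?_
    exact ((continuous_apply_apply i i).comp_continuousOn (continuousOn_chartGram x₀)).sqrt.mono hrt
  obtain ⟨y₀, hy₀, hmin⟩ := hDc.exists_isMinOn hDne hw
  obtain ⟨b, hb⟩ := hDc.bddAbove_image hw
  obtain ⟨B, hB⟩ := hDc.bddAbove_image hB
  refine ⟨r, hr, _, mul_pos (volumeDensity_pos (hrt hy₀)) (Real.exp_pos _), b, B, hrt,
    fun y hy ↦ ⟨hmin hy, hb (mem_image_of_mem _ hy), hB (mem_image_of_mem _ hy)⟩⟩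

variable [MeasurableSpace M] [BorelSpace M]

lemma setLIntegral_riemannianVolume (x₀ : M) {K : Set (EuclideanSpace ℝ (Fin n))}
    (hK : MeasurableSet K) (hKt : K ⊆ (extChartAt I x₀).target) {F : M → ℝ≥0∞}
    (hF : Measurable F) :
    ∫⁻ x in (extChartAt I x₀).source ∩ extChartAt I x₀ ⁻¹' K, F x ∂riemannianVolume I M =
      ∫⁻ y in K, ENNReal.ofReal (volumeDensity I x₀ y) * F ((extChartAt I x₀).symm y) := by
  have hT := measurableSet_extChartAt_target (I := I) x₀
  have hA := measurableSet_source_inter_preimage (I := I) x₀ hK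
  set A := (extChartAt I x₀).source ∩ extChartAt I x₀ ⁻¹' K with hAdef
  have hd : AEMeasurable (fun y ↦ ENNReal.ofReal (volumeDensity I x₀ y))
      (volume.restrict (extChartAt I x₀).target) :=
    ((continuousOn_volumeDensity x₀).aemeasurable hT).ennreal_ofReal
  have hs : AEMeasurable (extChartAt I x₀).symm
      (volume.restrict (extChartAt I x₀).target) :=
    (continuousOn_extChartAt_symm x₀).aemeasurable hT
  have h1 : (riemannianVolume I M).restrict A = (chartVolume I x₀).restrict A := by
    rw [← riemannianVolume_restrict_source x₀, Measure.restrict_restrict hA,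
      inter_eq_self_of_subset_left inter_subset_left]
  rw [h1, ← lintegral_indicator hA, chartVolume,
    lintegral_map' (hF.indicator hA).aemeasurable (aemeasurable_extChartAt_symm x₀ _),
    lintegral_withDensity_eq_lintegral_mul₀ hd
      (g := fun y ↦ A.indicator F ((extChartAt I x₀).symm y))
      ((hF.indicator hA).comp_aemeasurable hs)]
  have h2 : ∀ y ∈ (extChartAt I x₀).target,
      ((fun y ↦ ENNReal.ofReal (volumeDensity I x₀ y)) *
        fun y ↦ A.indicator F ((extChartAt I x₀).symm y)) y =
      K.indicator (fun y ↦ ENNReal.ofReal (volumeDensity I x₀ y) *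
        F ((extChartAt I x₀).symm y)) y := by
    intro y hy
    have hyA : (extChartAt I x₀).symm y ∈ A ↔ y ∈ K := by
      rw [hAdef, mem_inter_iff, mem_preimage, (extChartAt I x₀).right_inv hy]
      simp only [(extChartAt I x₀).map_target hy, true_and]
    by_cases hyK : y ∈ K
    · simp only [Pi.mul_apply, indicator_of_mem hyK, indicator_of_mem (hyA.2 hyK)]
    · simp only [Pi.mul_apply, indicator_of_notMem hyK, indicator_of_notMem (mt hyA.1 hyK),
        mul_zero]
  rw [setLIntegral_congr_fun hT h2, lintegral_indicator hK, Measure.restrict_restrict hK,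
    inter_eq_self_of_subset_left hKt]

/-- The density of the weighted volume in a chart. -/
lemma setLIntegral_weightedVolume {φ : M → ℝ} (hφ : Continuous φ) (x₀ : M)
    {K : Set (EuclideanSpace ℝ (Fin n))} (hK : MeasurableSet K)
    (hKt : K ⊆ (extChartAt I x₀).target) {F : M → ℝ≥0∞} (hF : Measurable F) :
    ∫⁻ x in (extChartAt I x₀).source ∩ extChartAt I x₀ ⁻¹' K, F x ∂weightedVolume I φ =
      ∫⁻ y in K, ENNReal.ofReal (volumeDensity I x₀ y *
        Real.exp (-φ ((extChartAt I x₀).symm y))) * F ((extChartAt I x₀).symm y) := by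
  have hw : Measurable fun x ↦ ENNReal.ofReal (Real.exp (-φ x)) :=
    ENNReal.measurable_ofReal.comp (Real.continuous_exp.comp hφ.neg).measurable
  rw [weightedVolume, setLIntegral_withDensity_eq_setLIntegral_mul _ hw hF
    (measurableSet_source_inter_preimage x₀ hK)]
  simp only [Pi.mul_apply]
  rw [setLIntegral_riemannianVolume x₀ hK hKt (F := fun x ↦ ENNReal.ofReal (Real.exp (-φ x)) * F x)
    (hw.mul hF)]
  refine setLIntegral_congr_fun hK fun y _ ↦ ?_
  rw [ENNReal.ofReal_mul (show 0 ≤ volumeDensity I x₀ y from Real.sqrt_nonneg _), mul_assoc]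

/-- The Poincaré inequality on convex sets of a chart. -/
lemma exists_chart_poincare {φ : M → ℝ} (hφ : Continuous φ) (x₀ : M) :
    ∃ r > 0, ∃ C : ℝ≥0∞, C ≠ ⊤ ∧
      ∀ K ⊆ Metric.closedBall (extChartAt I x₀ x₀) r ∩ range I, Convex ℝ K → MeasurableSet K →
      ∀ d : ℝ≥0∞, (∀ x ∈ K, ∀ y ∈ K, ‖y - x‖ₑ ≤ d) →
      ∀ f : M → ℝ, ContMDiff I 𝓘(ℝ, ℝ) 1 f → ∃ c : ℝ,
        ∫⁻ x in (extChartAt I x₀).source ∩ extChartAt I x₀ ⁻¹' K, ‖f x - c‖ₑ ^ 2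
          ∂weightedVolume I φ ≤
        C * d ^ 2 * ∫⁻ x in (extChartAt I x₀).source ∩ extChartAt I x₀ ⁻¹' K,
          ‖gradient I f x‖ₑ ^ 2 ∂weightedVolume I φ := by
  obtain ⟨r, hr, a, ha, b, B, hrt, h⟩ := exists_comparison_ball (I := I) hφ x₀
  -- Here b and a bound the weighted density above and below, and B compares the Euclidean norm of
  -- the differential with the Riemannian one. The constant depends on neither K nor d, so small
  -- cells gain the full factor d².
  refine ⟨r, hr, ENNReal.ofReal b * (2 ^ n * (ENNReal.ofReal B ^ 2 * (ENNReal.ofReal a)⁻¹)), ?_,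
    fun K hK hKc hKm d hd f hf ↦ ?_⟩
  · refine ENNReal.mul_ne_top ENNReal.ofReal_ne_top (ENNReal.mul_ne_top (by simp)
      (ENNReal.mul_ne_top (by simp) ?_))
    simpa using ha
  have hKt := hK.trans hrt
  have hKfin : volume K ≠ ⊤ :=
    (((Metric.isBounded_closedBall).subset (hK.trans inter_subset_left)).measure_lt_top).ne
  obtain ⟨c, hc⟩ := exists_lintegral_enorm_sub_sq_le volume hKc hKm
    (f := f ∘ (extChartAt I x₀).symm) (f' := chartDeriv I x₀ f)
    (fun y hy ↦ (hasFDerivWithinAt_chartDeriv hf (hKt hy)).mono hKt)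
    ((continuousOn_chartDeriv hf x₀).mono hKt) hd hKfin
  rw [finrank_euclideanSpace_fin] at hc
  refine ⟨c, ?_⟩
  have hgm : Measurable fun x ↦ ‖gradient I f x‖ₑ ^ 2 := by
    have : Measurable fun x ↦ ‖(‖gradient I f x‖)‖ₑ :=
      (continuous_norm_gradient hf).measurable.enorm
    simp only [enorm_norm] at this
    exact this.pow_const 2
  rw [setLIntegral_weightedVolume hφ x₀ hKm hKt
      (((hf.continuous.measurable.sub_const c).enorm).pow_const 2),
    setLIntegral_weightedVolume hφ x₀ hKm hKt hgm]
  have ha0 : ENNReal.ofReal a ≠ 0 := by simpa using ha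
  calc ∫⁻ y in K, ENNReal.ofReal (volumeDensity I x₀ y *
          Real.exp (-φ ((extChartAt I x₀).symm y))) * ‖f ((extChartAt I x₀).symm y) - c‖ₑ ^ 2
      ≤ ∫⁻ y in K, ENNReal.ofReal b * ‖f ((extChartAt I x₀).symm y) - c‖ₑ ^ 2 := by
        refine setLIntegral_mono' hKm fun y hy ↦ ?_
        gcongr
        exact (h y (hK hy)).2.1
    _ = ENNReal.ofReal b * ∫⁻ y in K, ‖f ((extChartAt I x₀).symm y) - c‖ₑ ^ 2 :=
        lintegral_const_mul' _ _ ENNReal.ofReal_ne_top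
    _ ≤ ENNReal.ofReal b * (d ^ 2 * 2 ^ n * ∫⁻ y in K, ‖chartDeriv I x₀ f y‖ₑ ^ 2) := by
        gcongr
        exact hc
    _ ≤ ENNReal.ofReal b * (d ^ 2 * 2 ^ n * ∫⁻ y in K,
          ENNReal.ofReal B ^ 2 * (ENNReal.ofReal a)⁻¹ *
          (ENNReal.ofReal (volumeDensity I x₀ y * Real.exp (-φ ((extChartAt I x₀).symm y))) *
            ‖gradient I f ((extChartAt I x₀).symm y)‖ₑ ^ 2)) := by
        refine mul_le_mul_right (mul_le_mul_right (setLIntegral_mono' hKm fun y hy ↦ ?_) _) _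
        have h1 : ‖chartDeriv I x₀ f y‖ₑ ≤ ENNReal.ofReal B *
            ‖gradient I f ((extChartAt I x₀).symm y)‖ₑ := by
          rw [← ofReal_norm, ← ofReal_norm, ← ENNReal.ofReal_mul' (norm_nonneg _)]
          refine ENNReal.ofReal_le_ofReal ((norm_chartDeriv_le x₀ y f).trans ?_)
          gcongr
          exact (h y (hK hy)).2.2
        calc ‖chartDeriv I x₀ f y‖ₑ ^ 2
            ≤ (ENNReal.ofReal B * ‖gradient I f ((extChartAt I x₀).symm y)‖ₑ) ^ 2 := by gcongr
          _ = ENNReal.ofReal B ^ 2 * ((ENNReal.ofReal a)⁻¹ * ENNReal.ofReal a) *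
              ‖gradient I f ((extChartAt I x₀).symm y)‖ₑ ^ 2 := by
              rw [ENNReal.inv_mul_cancel ha0 ENNReal.ofReal_ne_top]
              ring
          _ ≤ ENNReal.ofReal B ^ 2 * ((ENNReal.ofReal a)⁻¹ *
              ENNReal.ofReal (volumeDensity I x₀ y * Real.exp (-φ ((extChartAt I x₀).symm y)))) *
              ‖gradient I f ((extChartAt I x₀).symm y)‖ₑ ^ 2 := by
              gcongr
              exact (h y (hK hy)).1
          _ = _ := by ring
    _ = _ := by
        rw [lintegral_const_mul' _ _ (ENNReal.mul_ne_top (by simp) (by simpa using ha))]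
        ring

/-- Nonempty open sets have positive weighted volume. -/
lemma weightedVolume_pos_of_isOpen {φ : M → ℝ} (hφ : Continuous φ) {U : Set M} (hU : IsOpen U)
    (hne : U.Nonempty) : weightedVolume I φ U ≠ 0 := by
  obtain ⟨x₀, hx₀⟩ := hne
  intro h0
  set K := (extChartAt I x₀).target ∩ (extChartAt I x₀).symm ⁻¹' U with hK
  have hKm : MeasurableSet K := measurableSet_target_inter_preimage x₀ hU.measurableSet
  have h1 := setLIntegral_weightedVolume hφ x₀ hKm inter_subset_left
    (F := fun _ ↦ 1) measurable_const
  have h2 : weightedVolume I φ ((extChartAt I x₀).source ∩ extChartAt I x₀ ⁻¹' K) = 0 := by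
    refine measure_mono_null (fun x hx ↦ ?_) h0
    have := hx.2.2
    rwa [mem_preimage, (extChartAt I x₀).left_inv hx.1] at this
  rw [setLIntegral_one, h2] at h1
  have hKpos : volume K ≠ 0 := by
    have hnhds : K ∈ 𝓝[range I] (extChartAt I x₀ x₀) := by
      refine inter_mem (extChartAt_target_mem_nhdsWithin x₀) ?_
      refine nhdsWithin_le_nhds ?_
      exact (continuousAt_extChartAt_symm x₀) (by simpa using hU.mem_nhds hx₀)
    obtain ⟨V, hVo, hxV, hVK⟩ := mem_nhdsWithin.1 hnhds
    -- At a boundary point a relative neighbourhood still contains a nonempty Euclidean open set,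
    -- because the range of the model lies in the closure of its interior.
    have hcl := I.range_subset_closure_interior
      (extChartAt_target_subset_range x₀ (mem_extChartAt_target (I := I) x₀))
    obtain ⟨z, hzV, hzI⟩ := mem_closure_iff.1 hcl V hVo hxV
    refine (((hVo.inter isOpen_interior).measure_pos volume ⟨z, hzV, hzI⟩).trans_le
      (measure_mono fun y hy ↦ hVK ⟨hy.1, interior_subset hy.2⟩)).ne'
  have hw : ContinuousOn (fun y ↦ volumeDensity I x₀ y *
      Real.exp (-φ ((extChartAt I x₀).symm y))) K :=
    ((continuousOn_volumeDensity x₀).mul (Real.continuous_exp.comp_continuousOn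
      (hφ.comp_continuousOn (continuousOn_extChartAt_symm x₀)).neg)).mono inter_subset_left
  have h3 := (setLIntegral_eq_zero_iff' hKm
    ((hw.aemeasurable hKm).ennreal_ofReal.mul_const 1)).1 h1.symm
  refine hKpos (measure_eq_zero_iff_ae_notMem.2 ?_)
  filter_upwards [h3] with y hy hyK
  have h4 := hy hyK
  rw [mul_one, ENNReal.ofReal_eq_zero] at h4
  exact absurd h4 (not_le.2 (mul_pos (volumeDensity_pos hyK.1) (Real.exp_pos _)))

end ChartIntegral

/-! ### L² control by the gradient and finitely many integrals. -/

section Rellich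

/-- A partition of a bounded set of Euclidean space into finitely many small convex cells. -/
lemma exists_convex_partition (n : ℕ) {D : Set (EuclideanSpace ℝ (Fin n))}
    (hD : Bornology.IsBounded D) {d : ℝ} (hd : 0 < d) :
    ∃ (s : Finset (Fin n → ℤ)) (Q : (Fin n → ℤ) → Set (EuclideanSpace ℝ (Fin n))),
      (∀ m, Convex ℝ (Q m)) ∧ (∀ m, MeasurableSet (Q m)) ∧ Pairwise (Function.onFun Disjoint Q) ∧
      (D ⊆ ⋃ m ∈ s, Q m) ∧ ∀ m, ∀ x ∈ Q m, ∀ y ∈ Q m, ‖y - x‖ ≤ d := by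
  obtain ⟨R, hR⟩ := hD.exists_norm_le
  -- A cube of side δ has diameter at most √n δ ≤ d. The denominator n + 1 also covers n = 0.
  -- Half-open cubes, cut out by floors, are disjoint and convex.
  set δ : ℝ := d / (n + 1) with hδ
  have hδ0 : 0 < δ := by positivity
  have hcoord : ∀ i : Fin n, Measurable fun y : EuclideanSpace ℝ (Fin n) ↦ y i := fun i ↦
    (EuclideanSpace.proj (𝕜 := ℝ) i).continuous.measurable
  have hmem : ∀ (m : Fin n → ℤ) (y : EuclideanSpace ℝ (Fin n)),
      y ∈ {y : EuclideanSpace ℝ (Fin n) | ∀ i, ⌊y i / δ⌋ = m i} ↔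
        ∀ i, m i * δ ≤ y i ∧ y i < (m i + 1) * δ := by
    intro m y
    simp only [mem_ofPred_eq, Int.floor_eq_iff, le_div_iff₀ hδ0, div_lt_iff₀ hδ0]
  refine ⟨Fintype.piFinset fun _ ↦ Finset.Icc ⌊-R / δ⌋ ⌊R / δ⌋,
    fun m ↦ {y | ∀ i, ⌊y i / δ⌋ = m i}, fun m ↦ ?_, fun m ↦ ?_, fun m m' hne ↦ ?_,
    fun y hy ↦ ?_, fun m x hx y hy ↦ ?_⟩
  · have : {y : EuclideanSpace ℝ (Fin n) | ∀ i, ⌊y i / δ⌋ = m i} =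
        ⋂ i, ({y | m i * δ ≤ EuclideanSpace.proj (𝕜 := ℝ) i y} ∩
          {y | EuclideanSpace.proj (𝕜 := ℝ) i y < (m i + 1) * δ}) := by
      ext y
      rw [hmem]
      simp
    simp only [this]
    exact convex_iInter fun i ↦
      (convex_halfSpace_ge (EuclideanSpace.proj (𝕜 := ℝ) i).toLinearMap.isLinear _).inter
        (convex_halfSpace_lt (EuclideanSpace.proj (𝕜 := ℝ) i).toLinearMap.isLinear _)
  · simp only [ofPred_forall]
    exact MeasurableSet.iInter fun i ↦
      ((hcoord i).div_const δ).floor (measurableSet_singleton (m i))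
  · refine disjoint_left.2 fun y hy hy' ↦ hne (funext fun i ↦ ?_)
    exact (hy i).symm.trans (hy' i)
  · refine mem_iUnion₂.2 ⟨fun i ↦ ⌊y i / δ⌋, ?_, fun i ↦ rfl⟩
    refine Fintype.mem_piFinset.2 fun i ↦ Finset.mem_Icc.2 ?_
    have h1 : |y i| ≤ R := (PiLp.norm_apply_le y i).trans (hR y hy)
    rw [abs_le] at h1
    constructor
    · gcongr; exact h1.1
    · gcongr; exact h1.2
  · rw [hmem] at hx hy
    have h1 : ∀ i, ‖(y - x) i‖ ≤ δ := fun i ↦ by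
      have h2 := hx i
      have h3 := hy i
      rw [Real.norm_eq_abs, abs_le]
      simp only [PiLp.sub_apply]
      constructor <;> nlinarith
    rw [EuclideanSpace.norm_eq]
    refine Real.sqrt_le_iff.2 ⟨hd.le, ?_⟩
    calc ∑ i, ‖(y - x) i‖ ^ 2 ≤ ∑ _i : Fin n, δ ^ 2 :=
          Finset.sum_le_sum fun i _ ↦ by gcongr; exact h1 i
      _ = n * δ ^ 2 := by simp
      _ ≤ ((n + 1) * δ) ^ 2 := by nlinarith [sq_nonneg δ, (Nat.cast_nonneg n : (0 : ℝ) ≤ n)]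
      _ = d ^ 2 := by rw [hδ]; field_simp

/-- The mean minimises the squared deviation, and the deviation from it is ∫f² - (∫f)²/μ(A). On a
null set the quotient is 0 by convention and every term vanishes. -/
lemma setIntegral_sq_le {α : Type*} [MeasurableSpace α] {μ : Measure α} [IsFiniteMeasure μ]
    {f : α → ℝ} (hf : MemLp f 2 μ) (A : Set α) (c : ℝ) :
    ∫ x in A, f x ^ 2 ∂μ ≤ ∫ x in A, (f x - c) ^ 2 ∂μ + (∫ x in A, f x ∂μ) ^ 2 / μ.real A := by
  have hfA := hf.restrict A
  have h1 : Integrable f (μ.restrict A) := hfA.integrable (by norm_num)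
  have h2 : Integrable (fun x ↦ f x ^ 2) (μ.restrict A) := hfA.integrable_sq
  have h3 : ∫ x in A, (f x - c) ^ 2 ∂μ =
      ∫ x in A, f x ^ 2 ∂μ - 2 * c * ∫ x in A, f x ∂μ + c ^ 2 * μ.real A := by
    have : ∀ x, (f x - c) ^ 2 = f x ^ 2 - 2 * c * f x + c ^ 2 := fun x ↦ by ring
    simp_rw [this]
    rw [integral_add (f := fun x ↦ f x ^ 2 - 2 * c * f x) (h2.sub (h1.const_mul _))
        (integrable_const _), integral_sub h2 (h1.const_mul _), integral_const_mul,
      setIntegral_const, smul_eq_mul]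
    ring
  rw [h3]
  rcases eq_or_lt_of_le (measureReal_nonneg (μ := μ) (s := A)) with h0 | hpos
  · have hz : μ.restrict A = 0 := by
      rw [Measure.restrict_eq_zero, ← measureReal_eq_zero_iff]
      exact h0.symm
    simp [hz, ← h0]
  · have : 0 ≤ ((∫ x in A, f x ∂μ) - c * μ.real A) ^ 2 / μ.real A := by positivity
    have h4 : ((∫ x in A, f x ∂μ) - c * μ.real A) ^ 2 / μ.real A =
        (∫ x in A, f x ∂μ) ^ 2 / μ.real A - 2 * c * ∫ x in A, f x ∂μ + c ^ 2 * μ.real A := by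
      field_simp
      ring
    linarith

variable {n : ℕ} {H : Type*} [TopologicalSpace H]
    {I : ModelWithCorners ℝ (EuclideanSpace ℝ (Fin n)) H}
    {M : Type*} [TopologicalSpace M] [ChartedSpace H M]

variable [CompactSpace M] [IsManifold I 1 M] [RiemannianBundle (fun x : M ↦ TangentSpace I x)]
  [IsContMDiffRiemannianBundle I 0 (EuclideanSpace ℝ (Fin n)) (fun x : M ↦ TangentSpace I x)]
  [MeasurableSpace M] [BorelSpace M]

lemma memLp_of_continuous {X : Type*} [TopologicalSpace X] [CompactSpace X] [MeasurableSpace X]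
    [BorelSpace X] {μ : Measure X} [IsFiniteMeasure μ] {f : X → ℝ} (hf : Continuous f)
    (p : ℝ≥0∞) : MemLp f p μ := by
  obtain ⟨C, hC⟩ := isCompact_univ.exists_bound_of_continuousOn hf.continuousOn
  exact MemLp.of_bound hf.aestronglyMeasurable C (ae_of_all _ fun x ↦ hC x (mem_univ x))

lemma exists_chart_poincare_integral {φ : M → ℝ} (hφ : Continuous φ)
    [IsFiniteMeasure (weightedVolume I φ)] (x₀ : M) :
    ∃ r > 0, ∃ C : ℝ, 0 ≤ C ∧
      ∀ K ⊆ Metric.closedBall (extChartAt I x₀ x₀) r ∩ range I, Convex ℝ K → MeasurableSet K →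
      ∀ d : ℝ, (∀ x ∈ K, ∀ y ∈ K, ‖y - x‖ ≤ d) →
      ∀ f : M → ℝ, ContMDiff I 𝓘(ℝ, ℝ) 1 f → ∃ c : ℝ,
        ∫ x in (extChartAt I x₀).source ∩ extChartAt I x₀ ⁻¹' K, (f x - c) ^ 2
          ∂weightedVolume I φ ≤
        C * d ^ 2 * ∫ x in (extChartAt I x₀).source ∩ extChartAt I x₀ ⁻¹' K,
          ‖gradient I f x‖ ^ 2 ∂weightedVolume I φ := by
  obtain ⟨r, hr, C, hC, h⟩ := exists_chart_poincare (I := I) hφ x₀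
  refine ⟨r, hr, C.toReal, ENNReal.toReal_nonneg, fun K hK hKc hKm d hd f hf ↦ ?_⟩
  obtain ⟨c, hc⟩ := h K hK hKc hKm (ENNReal.ofReal d) (fun x hx y hy ↦ by
    rw [← ofReal_norm]; exact ENNReal.ofReal_le_ofReal (hd x hx y hy)) f hf
  refine ⟨c, ?_⟩
  set A := (extChartAt I x₀).source ∩ extChartAt I x₀ ⁻¹' K
  have key : ∀ {g : M → ℝ}, Continuous g → ∫⁻ x in A, ‖g x‖ₑ ^ 2 ∂weightedVolume I φ =
      ENNReal.ofReal (∫ x in A, g x ^ 2 ∂weightedVolume I φ) := by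
    intro g hg
    rw [ofReal_integral_eq_lintegral_ofReal
      (((memLp_of_continuous hg 2).restrict A).integrable_sq) (ae_of_all _ fun x ↦ sq_nonneg _)]
    refine lintegral_congr fun x ↦ ?_
    rw [← sq_abs, ENNReal.ofReal_pow (abs_nonneg _), ← Real.norm_eq_abs, ofReal_norm]
  have hgr := key (continuous_norm_gradient hf)
  simp only [enorm_norm] at hgr
  rw [key (g := fun x ↦ f x - c) (hf.continuous.sub continuous_const), hgr] at hc
  -- A negative d is possible only for empty K, so nonemptiness is what identifies the square of
  -- `ENNReal.ofReal d` with d².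
  by_cases hK0 : K.Nonempty
  · obtain ⟨y, hy⟩ := hK0
    have hd0 : 0 ≤ d := (norm_nonneg _).trans (hd y hy y hy)
    rw [← ENNReal.ofReal_toReal hC, ← ENNReal.ofReal_pow hd0, ← ENNReal.ofReal_mul
      ENNReal.toReal_nonneg, ← ENNReal.ofReal_mul (by positivity)] at hc
    rwa [ENNReal.ofReal_le_ofReal_iff] at hc
    exact mul_nonneg (by positivity) (integral_nonneg fun x ↦ sq_nonneg _)
  · have : A = ∅ := by
      simp [A, not_nonempty_iff_eq_empty.1 hK0]
    simp [this]

variable (I) in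
/-- Around each point, functions are controlled in `L²` by their gradients and finitely many
integrals. -/
lemma exists_local_estimates {φ : M → ℝ} (hφ : Continuous φ)
    [IsFiniteMeasure (weightedVolume I φ)] (x₀ : M) :
    ∃ P ∈ 𝓝 x₀, MeasurableSet P ∧
      (∃ C : ℝ, ∀ f : M → ℝ, ContMDiff I 𝓘(ℝ, ℝ) 1 f → ∃ c : ℝ,
        ∫ x in P, (f x - c) ^ 2 ∂weightedVolume I φ ≤
          C * ∫ x in P, ‖gradient I f x‖ ^ 2 ∂weightedVolume I φ) ∧
      ∀ ε > 0, ∃ T : Finset (Set M), ∃ C : ℝ, 0 ≤ C ∧ ∀ f : M → ℝ, ContMDiff I 𝓘(ℝ, ℝ) 1 f →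
        ∫ x in P, f x ^ 2 ∂weightedVolume I φ ≤
          ε * ∫ x in P, ‖gradient I f x‖ ^ 2 ∂weightedVolume I φ +
            C * ∑ A ∈ T, (∫ x in A, f x ∂weightedVolume I φ) ^ 2 := by
  classical
  obtain ⟨r, hr, C, hC, h⟩ := exists_chart_poincare_integral (I := I) hφ x₀
  set D := Metric.closedBall (extChartAt I x₀ x₀) r ∩ range I with hD
  have hDm : MeasurableSet D := Metric.isClosed_closedBall.measurableSet.inter
    I.isClosed_range.measurableSet
  have hDc : Convex ℝ D := (convex_closedBall _ _).inter I.convex_range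
  have hDb : Bornology.IsBounded D := Metric.isBounded_closedBall.subset inter_subset_left
  refine ⟨_, ball_mem_nhds hr, measurableSet_source_inter_preimage x₀ hDm, ?_, fun ε hε ↦ ?_⟩
  · refine ⟨_, h D subset_rfl hDc hDm (2 * r) fun x hx y hy ↦ ?_⟩
    rw [← dist_eq_norm]
    calc dist y x ≤ dist y (extChartAt I x₀ x₀) + dist x (extChartAt I x₀ x₀) :=
          dist_triangle_right _ _ _
      _ ≤ 2 * r := by linarith [Metric.mem_closedBall.1 hx.1, Metric.mem_closedBall.1 hy.1]
  -- The cell diameter d makes the Poincaré constant C d² at most ε; dividing by C + 1 allows C = 0.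
  · obtain ⟨d, hd, hdε⟩ : ∃ d : ℝ, 0 < d ∧ C * d ^ 2 ≤ ε := by
      refine ⟨Real.sqrt (ε / (C + 1)), by positivity, ?_⟩
      rw [Real.sq_sqrt (by positivity), mul_div_assoc', div_le_iff₀ (by positivity)]
      nlinarith
    obtain ⟨s, Q, hQc, hQm, hQd, hDQ, hQdiam⟩ := exists_convex_partition n hDb hd
    set A : (Fin n → ℤ) → Set M := fun m ↦
      (extChartAt I x₀).source ∩ extChartAt I x₀ ⁻¹' (D ∩ Q m) with hA
    have hAm : ∀ m, MeasurableSet (A m) := fun m ↦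
      measurableSet_source_inter_preimage x₀ (hDm.inter (hQm m))
    have hAd : Pairwise (Function.onFun Disjoint A) := fun m m' hne ↦
      disjoint_left.2 fun x hx hx' ↦ disjoint_left.1 (hQd hne) hx.2.2 hx'.2.2
    have hPA : (extChartAt I x₀).source ∩ extChartAt I x₀ ⁻¹' D = ⋃ m ∈ s, A m := by
      ext x
      simp only [hA, mem_iUnion, mem_inter_iff, mem_preimage]
      constructor
      · rintro ⟨hx, hxD⟩
        obtain ⟨m, hm, hxm⟩ := mem_iUnion₂.1 (hDQ hxD)
        exact ⟨m, hm, hx, hxD, hxm⟩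
      · rintro ⟨m, hm, hx, hxD, -⟩
        exact ⟨hx, hxD⟩
    -- Different indices may give the same set, for instance the empty one, so each cell's mean term
    -- is bounded by the whole sum over the image. This is why the inverse measures are added up.
    -- Null cells contribute the inverse 0.
    refine ⟨s.image A, ∑ m ∈ s, ((weightedVolume I φ).real (A m))⁻¹,
      Finset.sum_nonneg fun m _ ↦ by positivity, fun f hf ↦ ?_⟩
    have hf2 : MemLp f 2 (weightedVolume I φ) := memLp_of_continuous hf.continuous 2
    have hg2 : MemLp (fun x ↦ ‖gradient I f x‖) 2 (weightedVolume I φ) :=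
      memLp_of_continuous (continuous_norm_gradient hf) 2
    rw [hPA, integral_biUnion_finset s (fun m _ ↦ hAm m) (hAd.set_pairwise _)
        fun m _ ↦ hf2.integrable_sq.integrableOn,
      integral_biUnion_finset s (fun m _ ↦ hAm m) (hAd.set_pairwise _)
        fun m _ ↦ hg2.integrable_sq.integrableOn, Finset.mul_sum, Finset.sum_mul,
      ← Finset.sum_add_distrib]
    refine Finset.sum_le_sum fun m hm ↦ ?_
    obtain ⟨c, hc⟩ := h (D ∩ Q m) inter_subset_left (hDc.inter (hQc m)) (hDm.inter (hQm m)) d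
      (fun x hx y hy ↦ hQdiam m x hx.2 y hy.2) f hf
    refine (setIntegral_sq_le hf2 (A m) c).trans (add_le_add (hc.trans ?_) ?_)
    · exact mul_le_mul_of_nonneg_right hdε (integral_nonneg fun x ↦ sq_nonneg _)
    · rw [div_eq_inv_mul]
      refine mul_le_mul_of_nonneg_left ?_ (by positivity)
      exact Finset.single_le_sum
        (f := fun A : Set M ↦ (∫ x in A, f x ∂weightedVolume I φ) ^ 2)
        (fun _ _ ↦ sq_nonneg _) (Finset.mem_image_of_mem A hm)

variable (I) in
/-- The quantitative form of Rellich's theorem. -/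
lemma exists_integral_sq_le {φ : M → ℝ} (hφ : Continuous φ)
    [IsFiniteMeasure (weightedVolume I φ)] {ε : ℝ} (hε : 0 < ε) :
    ∃ T : Finset (Set M), ∃ C : ℝ, 0 ≤ C ∧ ∀ f : M → ℝ, ContMDiff I 𝓘(ℝ, ℝ) 1 f →
      ∫ x, f x ^ 2 ∂weightedVolume I φ ≤
        ε * ∫ x, ‖gradient I f x‖ ^ 2 ∂weightedVolume I φ +
          C * ∑ A ∈ T, (∫ x in A, f x ∂weightedVolume I φ) ^ 2 := by
  classical
  choose P hP hPm _ hloc using exists_local_estimates I hφ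
  obtain ⟨t, -, ht⟩ := isCompact_univ.elim_nhds_subcover P fun x _ ↦ hP x
  -- Each of the `t.card` local estimates is charged the full gradient integral, so ε is shared
  -- among them.
  have hε' : 0 < ε / (t.card + 1) := by positivity
  choose T C hC h using fun x ↦ hloc x _ hε'
  refine ⟨t.biUnion T, ∑ x ∈ t, C x, Finset.sum_nonneg fun x _ ↦ hC x, fun f hf ↦ ?_⟩
  have hf2 : MemLp f 2 (weightedVolume I φ) := memLp_of_continuous hf.continuous 2
  have hg2 : MemLp (fun x ↦ ‖gradient I f x‖) 2 (weightedVolume I φ) :=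
    memLp_of_continuous (continuous_norm_gradient hf) 2
  have hcover : ∫ x, f x ^ 2 ∂weightedVolume I φ ≤
      ∑ x₀ ∈ t, ∫ x in P x₀, f x ^ 2 ∂weightedVolume I φ := by
    simp_rw [← integral_indicator (hPm _)]
    rw [← integral_finsetSum _ fun x₀ _ ↦ hf2.integrable_sq.indicator (hPm x₀)]
    refine integral_mono hf2.integrable_sq
      (integrable_finsetSum _ fun x₀ _ ↦ hf2.integrable_sq.indicator (hPm x₀)) fun x ↦ ?_
    obtain ⟨x₀, hx₀, hx⟩ := mem_iUnion₂.1 (ht (mem_univ x))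
    calc f x ^ 2 = (P x₀).indicator (fun x ↦ f x ^ 2) x :=
          (indicator_of_mem hx (fun x ↦ f x ^ 2)).symm
      _ ≤ ∑ y ∈ t, (P y).indicator (fun x ↦ f x ^ 2) x :=
          Finset.single_le_sum (f := fun y ↦ (P y).indicator (fun x ↦ f x ^ 2) x)
            (fun y _ ↦ indicator_nonneg (fun z _ ↦ sq_nonneg (f z)) x) hx₀
  refine hcover.trans ((Finset.sum_le_sum fun x₀ hx₀ ↦ (h x₀ f hf).trans (add_le_add
    (mul_le_mul_of_nonneg_left (setIntegral_le_integral hg2.integrable_sq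
      (ae_of_all _ fun x ↦ sq_nonneg _)) hε'.le)
    (mul_le_mul_of_nonneg_left (Finset.sum_le_sum_of_subset_of_nonneg
      (Finset.subset_biUnion_of_mem T hx₀) fun _ _ _ ↦ sq_nonneg _) (hC x₀)))).trans ?_)
  rw [Finset.sum_add_distrib, Finset.sum_const, nsmul_eq_mul, ← Finset.sum_mul]
  refine add_le_add ?_ le_rfl
  rw [← mul_assoc]
  refine mul_le_mul_of_nonneg_right ?_ (integral_nonneg fun x ↦ sq_nonneg _)
  rw [mul_div_assoc', div_le_iff₀ (by positivity)]
  nlinarith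

end Rellich

/-! ### Convergence of square integrals of real functions. -/

section SquareIntegrals

variable {α : Type*} [MeasurableSpace α] {μ : Measure α}

lemma eLpNorm_two_eq {g : α → ℝ} (hg : MemLp g 2 μ) :
    eLpNorm g 2 μ = ENNReal.ofReal (Real.sqrt (∫ x, g x ^ 2 ∂μ)) := by
  rw [hg.eLpNorm_eq_integral_rpow_norm (by norm_num) (by norm_num)]
  simp [Real.sqrt_eq_rpow]

lemma tendsto_eLpNorm_two_iff {g : ℕ → α → ℝ} (hg : ∀ k, MemLp (g k) 2 μ) :
    Tendsto (fun k ↦ eLpNorm (g k) 2 μ) atTop (𝓝 0) ↔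
      Tendsto (fun k ↦ ∫ x, g k x ^ 2 ∂μ) atTop (𝓝 0) := by
  simp_rw [fun k ↦ eLpNorm_two_eq (hg k)]
  constructor
  · intro h
    have h1 := (ENNReal.tendsto_toReal ENNReal.zero_ne_top).comp h
    simp only [Function.comp_def, ENNReal.toReal_ofReal (Real.sqrt_nonneg _),
      ENNReal.toReal_zero] at h1
    have h2 := h1.pow 2
    simpa only [Real.sq_sqrt (integral_nonneg fun x ↦ sq_nonneg (g _ x)), ne_eq,
      OfNat.ofNat_ne_zero, not_false_eq_true, zero_pow] using h2
  · intro h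
    have h1 := ENNReal.tendsto_ofReal h.sqrt
    simpa using h1

lemma integral_add_const_mul_add_const_mul {p q r : α → ℝ} (hp : Integrable p μ)
    (hq : Integrable q μ) (hr : Integrable r μ) (c d : ℝ) :
    ∫ x, (p x + c * q x + d * r x) ∂μ = ∫ x, p x ∂μ + c * ∫ x, q x ∂μ + d * ∫ x, r x ∂μ := by
  rw [integral_add (f := fun x ↦ p x + c * q x) (hp.add (hq.const_mul c)) (hr.const_mul d),
    integral_add hp (hq.const_mul c), integral_const_mul, integral_const_mul]

lemma integral_sub_mean_sq [IsFiniteMeasure μ] {f : α → ℝ} (hf : MemLp f 2 μ)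
    (hV : μ.real univ ≠ 0) :
    ∫ x, (f x - (∫ x, f x ∂μ) / μ.real univ) ^ 2
        ∂μ =
      ∫ x, f x ^ 2 ∂μ -
        (∫ x, f x ∂μ) ^ 2 / μ.real univ := by
  set m := (∫ x, f x ∂μ) / μ.real univ with hm
  have h1 : ∀ x, (f x - m) ^ 2 = f x ^ 2 + (-2 * m) * f x + m ^ 2 * 1 := fun x ↦ by ring
  rw [integral_congr_ae (ae_of_all _ h1), integral_add_const_mul_add_const_mul hf.integrable_sq
    (hf.integrable (by norm_num)) (integrable_const 1), integral_const, smul_eq_mul, mul_one, hm]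
  field_simp
  ring

lemma integral_add_sq_le {a b : α → ℝ} (ha : MemLp a 2 μ) (hb : MemLp b 2 μ) :
    ∫ x, (a x + b x) ^ 2 ∂μ ≤ 2 * ∫ x, a x ^ 2 ∂μ + 2 * ∫ x, b x ^ 2 ∂μ := by
  rw [← integral_const_mul, ← integral_const_mul,
    ← integral_add (ha.integrable_sq.const_mul 2) (hb.integrable_sq.const_mul 2)]
  refine integral_mono (ha.add hb).integrable_sq
    ((ha.integrable_sq.const_mul 2).add (hb.integrable_sq.const_mul 2)) fun x ↦ ?_
  have := sq_nonneg (a x - b x)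
  simp only
  nlinarith

lemma tendsto_integral_add_sq {a b : ℕ → α → ℝ} (ha : ∀ k, MemLp (a k) 2 μ)
    (hb : ∀ k, MemLp (b k) 2 μ) (hat : Tendsto (fun k ↦ ∫ x, a k x ^ 2 ∂μ) atTop (𝓝 0))
    (hbt : Tendsto (fun k ↦ ∫ x, b k x ^ 2 ∂μ) atTop (𝓝 0)) :
    Tendsto (fun k ↦ ∫ x, (a k x + b k x) ^ 2 ∂μ) atTop (𝓝 0) := by
  have h : Tendsto (fun k ↦ 2 * ∫ x, a k x ^ 2 ∂μ + 2 * ∫ x, b k x ^ 2 ∂μ) atTop (𝓝 0) := by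
    simpa using (hat.const_mul 2).add (hbt.const_mul 2)
  exact squeeze_zero (fun k ↦ integral_nonneg fun x ↦ sq_nonneg _)
    (fun k ↦ integral_add_sq_le (ha k) (hb k)) h

lemma integral_sq_mono {a b : α → ℝ} (hb : MemLp b 2 μ) (h : ∀ x, |a x| ≤ b x) :
    ∫ x, a x ^ 2 ∂μ ≤ ∫ x, b x ^ 2 ∂μ := by
  refine integral_mono_of_nonneg (ae_of_all _ fun x ↦ sq_nonneg _) hb.integrable_sq
    (ae_of_all _ fun x ↦ ?_)
  exact sq_le_sq' (by linarith [neg_abs_le (a x), h x]) ((le_abs_self _).trans (h x))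

/-- Cauchy-Schwarz: the quadratic t ↦ ∫(ta + b)² is nonnegative, so its discriminant is not
positive. -/
lemma sq_integral_mul_le {a b : α → ℝ} (ha : MemLp a 2 μ) (hb : MemLp b 2 μ) :
    (∫ x, a x * b x ∂μ) ^ 2 ≤ (∫ x, a x ^ 2 ∂μ) * ∫ x, b x ^ 2 ∂μ := by
  have hab : Integrable (fun x ↦ a x * b x) μ := ha.integrable_mul hb
  have h : ∀ t : ℝ, 0 ≤ (∫ x, a x ^ 2 ∂μ) * (t * t) + 2 * (∫ x, a x * b x ∂μ) * t +
      ∫ x, b x ^ 2 ∂μ := by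
    intro t
    have h0 : 0 ≤ ∫ x, (t * a x + b x) ^ 2 ∂μ := integral_nonneg fun x ↦ sq_nonneg _
    have h1 : ∀ x, (t * a x + b x) ^ 2 = (t * t) * a x ^ 2 + (2 * t) * (a x * b x) + b x ^ 2 :=
      fun x ↦ by ring
    simp_rw [h1] at h0
    rw [integral_add (f := fun x ↦ (t * t) * a x ^ 2 + (2 * t) * (a x * b x))
        ((ha.integrable_sq.const_mul _).add (hab.const_mul _)) hb.integrable_sq,
      integral_add (ha.integrable_sq.const_mul _) (hab.const_mul _), integral_const_mul,
      integral_const_mul] at h0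
    linarith
  have := discrim_le_zero h
  rw [discrim] at this
  nlinarith

/-- Expand a² = (a - b)² + 2(a - b)b + b². The majorant r allows a = ‖∇fₖ‖, b = ‖X‖, r = ‖∇fₖ - X‖,
so that convergence of energies follows from scalar functions and the reverse triangle inequality.
-/
lemma tendsto_integral_sq_of_abs_sub_le {a r : ℕ → α → ℝ} {b : α → ℝ}
    (ha : ∀ k, MemLp (a k) 2 μ) (hb : MemLp b 2 μ) (hr : ∀ k, MemLp (r k) 2 μ)
    (h : ∀ k x, |a k x - b x| ≤ r k x)
    (hrt : Tendsto (fun k ↦ ∫ x, r k x ^ 2 ∂μ) atTop (𝓝 0)) :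
    Tendsto (fun k ↦ ∫ x, a k x ^ 2 ∂μ) atTop (𝓝 (∫ x, b x ^ 2 ∂μ)) := by
  have hd : ∀ k, MemLp (fun x ↦ a k x - b x) 2 μ := fun k ↦ (ha k).sub hb
  have hdt : Tendsto (fun k ↦ ∫ x, (a k x - b x) ^ 2 ∂μ) atTop (𝓝 0) :=
    squeeze_zero (fun k ↦ integral_nonneg fun x ↦ sq_nonneg _)
      (fun k ↦ integral_sq_mono (hr k) (h k)) hrt
  have hmul : Tendsto (fun k ↦ ∫ x, (a k x - b x) * b x ∂μ) atTop (𝓝 0) := by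
    rw [tendsto_zero_iff_abs_tendsto_zero]
    have h1 : Tendsto (fun k ↦ Real.sqrt ((∫ x, (a k x - b x) ^ 2 ∂μ) * ∫ x, b x ^ 2 ∂μ)) atTop
        (𝓝 0) := by
      simpa using (hdt.mul_const (∫ x, b x ^ 2 ∂μ)).sqrt
    exact squeeze_zero (fun k ↦ abs_nonneg _)
      (fun k ↦ Real.abs_le_sqrt (sq_integral_mul_le (hd k) hb)) h1
  have hexp : ∀ k, ∫ x, a k x ^ 2 ∂μ =
      ∫ x, (a k x - b x) ^ 2 ∂μ + 2 * ∫ x, (a k x - b x) * b x ∂μ + ∫ x, b x ^ 2 ∂μ := by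
    intro k
    have h1 : ∀ x, a k x ^ 2 = (a k x - b x) ^ 2 + 2 * ((a k x - b x) * b x) + b x ^ 2 :=
      fun x ↦ by ring
    have hi : Integrable (fun x ↦ (a k x - b x) * b x) μ := (hd k).integrable_mul hb
    simp_rw [h1]
    rw [integral_add (f := fun x ↦ (a k x - b x) ^ 2 + 2 * ((a k x - b x) * b x))
        ((hd k).integrable_sq.add (hi.const_mul _)) hb.integrable_sq,
      integral_add (hd k).integrable_sq (hi.const_mul _), integral_const_mul]
  simp_rw [hexp]
  simpa using (hdt.add (hmul.const_mul 2)).add_const (∫ x, b x ^ 2 ∂μ)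

lemma tendsto_integral_of_tendsto_sq [IsFiniteMeasure μ] {a : ℕ → α → ℝ} {b : α → ℝ}
    (ha : ∀ k, MemLp (a k) 2 μ) (hb : MemLp b 2 μ)
    (h : Tendsto (fun k ↦ ∫ x, (a k x - b x) ^ 2 ∂μ) atTop (𝓝 0)) :
    Tendsto (fun k ↦ ∫ x, a k x ∂μ) atTop (𝓝 (∫ x, b x ∂μ)) := by
  have hd : ∀ k, MemLp (fun x ↦ a k x - b x) 2 μ := fun k ↦ (ha k).sub hb
  rw [tendsto_iff_dist_tendsto_zero]
  have h1 : Tendsto (fun k ↦ Real.sqrt ((∫ x, (a k x - b x) ^ 2 ∂μ) * ∫ _, (1 : ℝ) ^ 2 ∂μ)) atTop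
      (𝓝 0) := by
    have := (h.mul_const (∫ _, (1 : ℝ) ^ 2 ∂μ)).sqrt
    rwa [zero_mul, Real.sqrt_zero] at this
  refine squeeze_zero (fun k ↦ dist_nonneg) (fun k ↦ ?_) h1
  rw [Real.dist_eq, ← integral_sub ((ha k).integrable (by norm_num)) (hb.integrable (by norm_num))]
  refine Real.abs_le_sqrt ?_
  have := sq_integral_mul_le (hd k) (memLp_const (1 : ℝ))
  simpa only [mul_one] using this

lemma exists_subseq_ae_tendsto_zero {r : ℕ → α → ℝ} (hr : ∀ k, MemLp (r k) 2 μ)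
    (hrt : Tendsto (fun k ↦ ∫ x, r k x ^ 2 ∂μ) atTop (𝓝 0)) :
    ∃ ns : ℕ → ℕ, StrictMono ns ∧ ∀ᵐ x ∂μ, Tendsto (fun k ↦ r (ns k) x) atTop (𝓝 0) := by
  have h := (tendsto_eLpNorm_two_iff hr).2 hrt
  have h' : TendstoInMeasure μ r atTop (0 : α → ℝ) :=
    tendstoInMeasure_of_tendsto_eLpNorm two_ne_zero (fun k ↦ (hr k).1)
      aestronglyMeasurable_zero (by simpa using h)
  exact h'.exists_seq_tendsto_ae

end SquareIntegrals

/-! ### The calculus of pairs (u, ∇u) in H¹. -/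

section Pairs

variable {n : ℕ} {H : Type*} [TopologicalSpace H]
    {I : ModelWithCorners ℝ (EuclideanSpace ℝ (Fin n)) H}
    {M : Type*} [TopologicalSpace M] [ChartedSpace H M]

lemma contMDiff_one_of_smooth {f : M → ℝ} (hf : ContMDiff I 𝓘(ℝ, ℝ) ∞ f) :
    ContMDiff I 𝓘(ℝ, ℝ) 1 f := hf.of_le (by norm_cast)

lemma mdifferentiable_of_smooth {f : M → ℝ} (hf : ContMDiff I 𝓘(ℝ, ℝ) ∞ f) :
    MDifferentiable I 𝓘(ℝ, ℝ) f := hf.mdifferentiable (by simp)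

variable [RiemannianBundle (fun x : M ↦ TangentSpace I x)] [MeasurableSpace M] {φ : M → ℝ}

lemma memLp_of_smooth [CompactSpace M] [BorelSpace M]
    [IsFiniteMeasure (weightedVolume I φ)] {f : M → ℝ}
    (hf : ContMDiff I 𝓘(ℝ, ℝ) ∞ f) : MemLp f 2 (weightedVolume I φ) :=
  memLp_of_continuous hf.continuous 2

lemma HasGradient.exists_approx {u : M → ℝ} {X : (x : M) → TangentSpace I x}
    (h : HasGradient I φ u X) :
    ∃ f : ℕ → M → ℝ, (∀ k, ContMDiff I 𝓘(ℝ, ℝ) ∞ (f k)) ∧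
      (∀ k, MemLp (fun x ↦ f k x - u x) 2 (weightedVolume I φ)) ∧
      (∀ k, MemLp (fun x ↦ ‖gradient I (f k) x - X x‖) 2 (weightedVolume I φ)) ∧
      Tendsto (fun k ↦ ∫ x, (f k x - u x) ^ 2 ∂weightedVolume I φ) atTop (𝓝 0) ∧
      Tendsto (fun k ↦ ∫ x, ‖gradient I (f k) x - X x‖ ^ 2 ∂weightedVolume I φ) atTop
        (𝓝 0) := by
  obtain ⟨f, hf, h1, h2, h3, h4⟩ := h
  exact ⟨f, hf, h1, h2, (tendsto_eLpNorm_two_iff h1).1 h3, (tendsto_eLpNorm_two_iff h2).1 h4⟩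

lemma HasGradient.memLp [CompactSpace M] [BorelSpace M] [IsFiniteMeasure (weightedVolume I φ)]
    {u : M → ℝ} {X : (x : M) → TangentSpace I x} (h : HasGradient I φ u X) :
    MemLp u 2 (weightedVolume I φ) := by
  obtain ⟨f, hf, h1, -⟩ := h
  refine ((memLp_of_smooth (hf 0)).sub (h1 0)).ae_eq (ae_of_all _ fun x ↦ ?_)
  simp

variable [CompactSpace M] [IsManifold I 1 M]
  [IsContMDiffRiemannianBundle I 0 (EuclideanSpace ℝ (Fin n)) (fun x : M ↦ TangentSpace I x)]
  [BorelSpace M]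

lemma memLp_norm_gradient [IsFiniteMeasure (weightedVolume I φ)] {f : M → ℝ}
    (hf : ContMDiff I 𝓘(ℝ, ℝ) ∞ f) :
    MemLp (fun x ↦ ‖gradient I f x‖) 2 (weightedVolume I φ) :=
  memLp_of_continuous (continuous_norm_gradient (contMDiff_one_of_smooth hf)) 2

variable [IsFiniteMeasure (weightedVolume I φ)]

/-- A vector field which is an `L²` limit of gradients has a square integrable norm. -/
lemma memLp_norm_of_approx {Z : (x : M) → TangentSpace I x} {h r : ℕ → M → ℝ}
    (hh : ∀ k, ContMDiff I 𝓘(ℝ, ℝ) ∞ (h k)) (hr : ∀ k, MemLp (r k) 2 (weightedVolume I φ))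
    (hle : ∀ k x, ‖gradient I (h k) x - Z x‖ ≤ r k x)
    (hrt : Tendsto (fun k ↦ ∫ x, r k x ^ 2 ∂weightedVolume I φ) atTop (𝓝 0)) :
    MemLp (fun x ↦ ‖Z x‖) 2 (weightedVolume I φ) := by
  -- No measurability of Z is assumed. Along a subsequence the majorants tend to 0 almost
  -- everywhere, which exhibits ‖Z‖ as an almost everywhere limit of continuous functions.
  obtain ⟨ns, -, hns⟩ := exists_subseq_ae_tendsto_zero hr hrt
  have hmeas : AEStronglyMeasurable (fun x ↦ ‖Z x‖) (weightedVolume I φ) := by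
    refine aestronglyMeasurable_of_tendsto_ae atTop
      (f := fun k x ↦ ‖gradient I (h (ns k)) x‖)
      (fun k ↦ (memLp_norm_gradient (hh (ns k))).1) ?_
    filter_upwards [hns] with x hx
    rw [tendsto_iff_dist_tendsto_zero]
    refine squeeze_zero (fun k ↦ dist_nonneg) (fun k ↦ ?_) hx
    exact (dist_norm_norm_le _ _).trans (hle _ _)
  refine ((memLp_norm_gradient (hh 0)).add (hr 0)).mono' hmeas (ae_of_all _ fun x ↦ ?_)
  simp only [Pi.add_apply, norm_norm]
  calc ‖Z x‖ ≤ ‖gradient I (h 0) x‖ + ‖gradient I (h 0) x - Z x‖ := norm_le_insert _ _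
    _ ≤ _ := by gcongr; exact hle 0 x

/-- Reduces membership in H¹ to scalar majorants. Square integrability of ‖∇fₖ - X‖, measurability
included, is derived: for fixed k the field ∇fₖ - X is the limit of the gradients of fₖ - fⱼ as j →
∞. -/
lemma hasGradient_of_approx {u : M → ℝ} {X : (x : M) → TangentSpace I x} {f s r : ℕ → M → ℝ}
    (hu : AEStronglyMeasurable u (weightedVolume I φ))
    (hf : ∀ k, ContMDiff I 𝓘(ℝ, ℝ) ∞ (f k)) (hs : ∀ k, MemLp (s k) 2 (weightedVolume I φ))
    (hr : ∀ k, MemLp (r k) 2 (weightedVolume I φ))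
    (hsle : ∀ k x, |f k x - u x| ≤ s k x) (hrle : ∀ k x, ‖gradient I (f k) x - X x‖ ≤ r k x)
    (hst : Tendsto (fun k ↦ ∫ x, s k x ^ 2 ∂weightedVolume I φ) atTop (𝓝 0))
    (hrt : Tendsto (fun k ↦ ∫ x, r k x ^ 2 ∂weightedVolume I φ) atTop (𝓝 0)) :
    HasGradient I φ u X := by
  have h1 : ∀ k, MemLp (fun x ↦ f k x - u x) 2 (weightedVolume I φ) := fun k ↦
    (hs k).mono' ((memLp_of_smooth (hf k)).1.sub hu) (ae_of_all _ fun x ↦ hsle k x)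
  have h2 : ∀ k, MemLp (fun x ↦ ‖gradient I (f k) x - X x‖) 2 (weightedVolume I φ) := fun k ↦
    memLp_norm_of_approx (h := fun j x ↦ f k x - f j x) (r := r)
      (fun j ↦ (hf k).sub (hf j)) hr (fun j x ↦ by
        rw [gradient_sub (mdifferentiable_of_smooth (hf k)) (mdifferentiable_of_smooth (hf j)),
          sub_sub_sub_cancel_left, norm_sub_rev]
        exact hrle j x) hrt
  refine ⟨f, hf, h1, h2, (tendsto_eLpNorm_two_iff h1).2 ?_, (tendsto_eLpNorm_two_iff h2).2 ?_⟩
  · exact squeeze_zero (fun k ↦ integral_nonneg fun x ↦ sq_nonneg _)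
      (fun k ↦ integral_sq_mono (hs k) (hsle k)) hst
  · refine squeeze_zero (fun k ↦ integral_nonneg fun x ↦ sq_nonneg _)
      (fun k ↦ integral_sq_mono (hr k) fun x ↦ ?_) hrt
    rw [abs_norm]
    exact hrle k x

namespace HasGradient

variable {u v : M → ℝ} {X Y : (x : M) → TangentSpace I x}

lemma memLp_norm (h : HasGradient I φ u X) :
    MemLp (fun x ↦ ‖X x‖) 2 (weightedVolume I φ) := by
  obtain ⟨f, hf, -, h2, -, h4⟩ := h.exists_approx
  exact memLp_norm_of_approx hf h2 (fun _ _ ↦ le_rfl) h4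

lemma add (hu : HasGradient I φ u X) (hv : HasGradient I φ v Y) :
    HasGradient I φ (fun x ↦ u x + v x) (fun x ↦ X x + Y x) := by
  obtain ⟨f, hf, f1, f2, f3, f4⟩ := hu.exists_approx
  obtain ⟨g, hg, g1, g2, g3, g4⟩ := hv.exists_approx
  refine hasGradient_of_approx (f := fun k x ↦ f k x + g k x)
    (s := fun k x ↦ |f k x - u x| + |g k x - v x|)
    (r := fun k x ↦ ‖gradient I (f k) x - X x‖ + ‖gradient I (g k) x - Y x‖)
    (hu.memLp.1.add hv.memLp.1) (fun k ↦ (hf k).add (hg k))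
    (fun k ↦ (f1 k).abs.add (g1 k).abs) (fun k ↦ (f2 k).add (g2 k)) (fun k x ↦ ?_) (fun k x ↦ ?_)
    (tendsto_integral_add_sq (fun k ↦ (f1 k).abs) (fun k ↦ (g1 k).abs) (by simpa using f3)
      (by simpa using g3)) (tendsto_integral_add_sq f2 g2 f4 g4)
  · rw [add_sub_add_comm]
    exact abs_add_le _ _
  · rw [gradient_add (mdifferentiable_of_smooth (hf k)) (mdifferentiable_of_smooth (hg k)),
      add_sub_add_comm]
    exact norm_add_le _ _

lemma const_mul (c : ℝ) (hu : HasGradient I φ u X) :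
    HasGradient I φ (fun x ↦ c * u x) (fun x ↦ c • X x) := by
  obtain ⟨f, hf, f1, f2, f3, f4⟩ := hu.exists_approx
  have hlim : ∀ {a : ℕ → M → ℝ},
      Tendsto (fun k ↦ ∫ x, a k x ^ 2 ∂weightedVolume I φ) atTop (𝓝 0) →
      Tendsto (fun k ↦ ∫ x, (|c| * a k x) ^ 2 ∂weightedVolume I φ) atTop (𝓝 0) := by
    intro a ha
    simp_rw [mul_pow, integral_const_mul]
    have := ha.const_mul (|c| ^ 2)
    rwa [mul_zero] at this
  refine hasGradient_of_approx (f := fun k x ↦ c * f k x)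
    (s := fun k x ↦ |c| * |f k x - u x|) (r := fun k x ↦ |c| * ‖gradient I (f k) x - X x‖)
    (hu.memLp.1.const_mul c) (fun k ↦ contMDiff_const.mul (hf k))
    (fun k ↦ (f1 k).abs.const_mul _) (fun k ↦ (f2 k).const_mul _) (fun k x ↦ ?_) (fun k x ↦ ?_)
    (hlim (by simpa using f3)) (hlim f4)
  · rw [← mul_sub, abs_mul]
  · rw [gradient_const_mul c (mdifferentiable_of_smooth (hf k)), ← smul_sub, norm_smul,
      Real.norm_eq_abs]

variable (φ) in
lemma of_smooth {f : M → ℝ} (hf : ContMDiff I 𝓘(ℝ, ℝ) ∞ f) :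
    HasGradient I φ f (gradient I f) :=
  hasGradient_of_approx (f := fun _ ↦ f) (s := fun _ _ ↦ 0) (r := fun _ _ ↦ 0)
    hf.continuous.aestronglyMeasurable (fun _ ↦ hf) (fun _ ↦ MemLp.zero)
    (fun _ ↦ MemLp.zero) (by simp) (by simp) (by simp) (by simp)

/-- Polarisation: the norms of X ± Y are square integrable, while X and Y separately carry no
measurability as fields. -/
lemma integrable_inner (hu : HasGradient I φ u X) (hv : HasGradient I φ v Y) :
    Integrable (fun x ↦ inner ℝ (X x) (Y x)) (weightedVolume I φ) := by
  have h1 := (hu.add hv).memLp_norm.integrable_sq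
  have h2 := (hu.add (hv.const_mul (-1))).memLp_norm.integrable_sq
  refine ((h1.sub h2).div_const 4).congr (ae_of_all _ fun x ↦ ?_)
  simp only [Pi.sub_apply, neg_smul, one_smul, ← sub_eq_add_neg]
  rw [norm_add_sq_real, norm_sub_sq_real]
  ring

lemma integral_norm_add_smul_sq (hu : HasGradient I φ u X) (hv : HasGradient I φ v Y) (t : ℝ) :
    ∫ x, ‖X x + t • Y x‖ ^ 2 ∂weightedVolume I φ =
      ∫ x, ‖X x‖ ^ 2 ∂weightedVolume I φ + 2 * t * ∫ x, inner ℝ (X x) (Y x) ∂weightedVolume I φ +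
        t ^ 2 * ∫ x, ‖Y x‖ ^ 2 ∂weightedVolume I φ := by
  have h : ∀ x, ‖X x + t • Y x‖ ^ 2 =
      ‖X x‖ ^ 2 + 2 * t * inner ℝ (X x) (Y x) + t ^ 2 * ‖Y x‖ ^ 2 := fun x ↦ by
    rw [norm_add_sq_real, real_inner_smul_right, norm_smul, mul_pow, Real.norm_eq_abs, sq_abs]
    ring
  rw [integral_congr_ae (ae_of_all _ h)]
  exact integral_add_const_mul_add_const_mul hu.memLp_norm.integrable_sq (hu.integrable_inner hv)
    hv.memLp_norm.integrable_sq _ _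

end HasGradient

end Pairs

/-! ### Completeness of H¹ and Rellich's theorem. -/

section Compactness

variable {n : ℕ} {H : Type*} [TopologicalSpace H]
    {I : ModelWithCorners ℝ (EuclideanSpace ℝ (Fin n)) H}
    {M : Type*} [TopologicalSpace M] [ChartedSpace H M]

variable [CompactSpace M] [IsManifold I 1 M] [RiemannianBundle (fun x : M ↦ TangentSpace I x)]
  [IsContMDiffRiemannianBundle I 0 (EuclideanSpace ℝ (Fin n)) (fun x : M ↦ TangentSpace I x)]
  [MeasurableSpace M] [BorelSpace M] {φ : M → ℝ}

/-- From d ≤ 2^k d² + 2^{-k} one gets ∫d ≤ 2^{-k}(1 + μ(univ)), so the sum of the d's has finite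
integral. This supplies the fast subsequence in the completeness proof. -/
lemma ae_summable_of_integral_sq_le {α : Type*} [MeasurableSpace α] {μ : Measure α}
    [IsFiniteMeasure μ] {d : ℕ → α → ℝ} (hd : ∀ k, MemLp (d k) 2 μ) (hd0 : ∀ k x, 0 ≤ d k x)
    (h : ∀ k, ∫ x, d k x ^ 2 ∂μ ≤ (1 / 4) ^ k) : ∀ᵐ x ∂μ, Summable fun k ↦ d k x := by
  have hint : ∀ k, ∫ x, d k x ∂μ ≤ (1 / 2) ^ k * (1 + μ.real univ) := by
    intro k
    have h1 : ∀ x, d k x ≤ 2 ^ k * d k x ^ 2 + (1 / 2) ^ k := by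
      intro x
      have h2 : (2 : ℝ) ^ k * (1 / 2) ^ k = 1 := by rw [← mul_pow]; norm_num
      have h3 : (0 : ℝ) < 2 ^ k := by positivity
      have h4 : 0 ≤ ((2 : ℝ) ^ k * d k x - 1) ^ 2 := sq_nonneg _
      have h5 := hd0 k x
      have h6 : (2 : ℝ) ^ k * (d k x) ≤ 2 ^ k * (2 ^ k * d k x ^ 2 + (1 / 2) ^ k) := by
        rw [mul_add, h2]
        nlinarith
      exact le_of_mul_le_mul_left h6 h3
    calc ∫ x, d k x ∂μ ≤ ∫ x, (2 ^ k * d k x ^ 2 + (1 / 2) ^ k) ∂μ :=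
          integral_mono ((hd k).integrable (by norm_num))
            (((hd k).integrable_sq.const_mul _).add (integrable_const _)) h1
      _ = 2 ^ k * ∫ x, d k x ^ 2 ∂μ + (1 / 2) ^ k * μ.real univ := by
          rw [integral_add ((hd k).integrable_sq.const_mul _) (integrable_const _),
            integral_const_mul, integral_const, smul_eq_mul, mul_comm (μ.real univ)]
      _ ≤ 2 ^ k * (1 / 4) ^ k + (1 / 2) ^ k * μ.real univ := by gcongr; exact h k
      _ = (1 / 2) ^ k * (1 + μ.real univ) := by rw [← mul_pow]; norm_num; ring
  have hfin : ∫⁻ x, ∑' k, ENNReal.ofReal (d k x) ∂μ ≠ ⊤ := by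
    rw [lintegral_tsum fun k ↦ (hd k).1.aemeasurable.ennreal_ofReal]
    have hs : Summable fun k : ℕ ↦ ((1 : ℝ) / 2) ^ k * (1 + μ.real univ) :=
      summable_geometric_two.mul_right _
    refine ne_top_of_le_ne_top (hs.tsum_ofReal_ne_top) (ENNReal.tsum_le_tsum fun k ↦ ?_)
    rw [← ofReal_integral_eq_lintegral_ofReal ((hd k).integrable (by norm_num))
      (ae_of_all _ (hd0 k))]
    exact ENNReal.ofReal_le_ofReal (hint k)
  filter_upwards [ae_lt_top' (AEMeasurable.tsum fun k ↦
    (hd k).1.aemeasurable.ennreal_ofReal) hfin] with x hx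
  have := ENNReal.summable_toReal hx.ne
  simpa only [ENNReal.toReal_ofReal (hd0 _ x)] using this

variable [IsFiniteMeasure (weightedVolume I φ)]

lemma memLp_norm_gradient_sub {f g : M → ℝ} (hf : ContMDiff I 𝓘(ℝ, ℝ) ∞ f)
    (hg : ContMDiff I 𝓘(ℝ, ℝ) ∞ g) :
    MemLp (fun x ↦ ‖gradient I f x - gradient I g x‖) 2 (weightedVolume I φ) := by
  have h := memLp_norm_gradient (φ := φ) (hf.sub hg)
  refine h.ae_eq (ae_of_all _ fun x ↦ ?_)
  exact congrArg norm (gradient_sub (mdifferentiable_of_smooth hf) (mdifferentiable_of_smooth hg) x)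

/-- Completeness of `H¹(M)`. -/
lemma exists_hasGradient_of_cauchy {f : ℕ → M → ℝ} (hf : ∀ k, ContMDiff I 𝓘(ℝ, ℝ) ∞ (f k))
    {u : M → ℝ} (hu : MemLp u 2 (weightedVolume I φ))
    (hfu : Tendsto (fun k ↦ ∫ x, (f k x - u x) ^ 2 ∂weightedVolume I φ) atTop (𝓝 0))
    (hc : ∀ ε > 0, ∀ᶠ N in atTop, ∀ l ≥ N,
      ∫ x, ‖gradient I (f N) x - gradient I (f l) x‖ ^ 2 ∂weightedVolume I φ ≤ ε) :
    ∃ X : (x : M) → TangentSpace I x, HasGradient I φ u X ∧ ∃ ns : ℕ → ℕ, StrictMono ns ∧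
      (∀ k, MemLp (fun x ↦ ‖gradient I (f (ns k)) x - X x‖) 2 (weightedVolume I φ)) ∧
      Tendsto (fun k ↦ ∫ x, ‖gradient I (f (ns k)) x - X x‖ ^ 2 ∂weightedVolume I φ) atTop
        (𝓝 0) := by
  classical
  obtain ⟨ns, hns, hle⟩ := extraction_forall_of_eventually fun k : ℕ ↦
    hc ((1 / 4) ^ k) (by positivity)
  have hG : ∀ k l, MemLp (fun x ↦ ‖gradient I (f (ns k)) x - gradient I (f (ns l)) x‖) 2
      (weightedVolume I φ) := fun k l ↦ memLp_norm_gradient_sub (hf _) (hf _)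
  have hsum := ae_summable_of_integral_sq_le (fun k ↦ hG k (k + 1)) (fun _ _ ↦ norm_nonneg _)
    fun k ↦ hle k _ (hns.monotone k.le_succ)
  -- The limit is taken separately in each tangent space, a complete space, with value 0 where it
  -- does not exist. The exceptional set is null by summability of the increments.
  let X : (x : M) → TangentSpace I x := fun x ↦
    if h : ∃ L, Tendsto (fun k ↦ gradient I (f (ns k)) x) atTop (𝓝 L) then h.choose else 0
  have hX : ∀ᵐ x ∂weightedVolume I φ,
      Tendsto (fun k ↦ gradient I (f (ns k)) x) atTop (𝓝 (X x)) := by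
    filter_upwards [hsum] with x hx
    have : FiniteDimensional ℝ (TangentSpace I x) :=
      inferInstanceAs (FiniteDimensional ℝ (EuclideanSpace ℝ (Fin n)))
    have : CompleteSpace (TangentSpace I x) := FiniteDimensional.complete ℝ _
    have hcau : CauchySeq fun k ↦ gradient I (f (ns k)) x := by
      refine cauchySeq_of_summable_dist ?_
      simpa only [dist_eq_norm] using hx
    have hex : ∃ L, Tendsto (fun k ↦ gradient I (f (ns k)) x) atTop (𝓝 L) :=
      cauchySeq_tendsto_of_complete hcau
    simp only [X, dif_pos hex]
    exact hex.choose_spec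
  have hlim : ∀ k, ∀ᵐ x ∂weightedVolume I φ, Tendsto
      (fun l ↦ ‖gradient I (f (ns k)) x - gradient I (f (ns l)) x‖) atTop
      (𝓝 ‖gradient I (f (ns k)) x - X x‖) := fun k ↦ by
    filter_upwards [hX] with x hx
    exact (tendsto_const_nhds.sub hx).norm
  -- Fatou's lemma: let l → ∞ in the Cauchy estimate with k fixed.
  have hbound : ∀ k, eLpNorm (fun x ↦ ‖gradient I (f (ns k)) x - X x‖) 2 (weightedVolume I φ) ≤
      ENNReal.ofReal (Real.sqrt ((1 / 4) ^ k)) := by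
    intro k
    refine (Lp.eLpNorm_lim_le_liminf_eLpNorm (fun l ↦ (hG k l).1) _ (hlim k)).trans ?_
    refine (liminf_le_liminf ?_).trans_eq (liminf_const _)
    filter_upwards [eventually_ge_atTop k] with l hl
    rw [eLpNorm_two_eq (hG k l)]
    exact ENNReal.ofReal_le_ofReal (Real.sqrt_le_sqrt (hle k _ (hns.monotone hl)))
  have hmem : ∀ k, MemLp (fun x ↦ ‖gradient I (f (ns k)) x - X x‖) 2 (weightedVolume I φ) :=
    fun k ↦ ⟨aestronglyMeasurable_of_tendsto_ae atTop (fun l ↦ (hG k l).1) (hlim k),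
      (hbound k).trans_lt ENNReal.ofReal_lt_top⟩
  have hzero : Tendsto (fun k ↦ eLpNorm (fun x ↦ ‖gradient I (f (ns k)) x - X x‖) 2
      (weightedVolume I φ)) atTop (𝓝 0) := by
    refine tendsto_of_tendsto_of_tendsto_of_le_of_le tendsto_const_nhds ?_ (fun _ ↦ zero_le)
      hbound
    have h1 := ENNReal.tendsto_ofReal
      (tendsto_pow_atTop_nhds_zero_of_lt_one (r := (1 / 4 : ℝ)) (by norm_num) (by norm_num)).sqrt
    simpa only [Real.sqrt_zero, ENNReal.ofReal_zero] using h1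
  have hfu' : ∀ k, MemLp (fun x ↦ f (ns k) x - u x) 2 (weightedVolume I φ) := fun k ↦
    (memLp_of_smooth (hf (ns k))).sub hu
  refine ⟨X, ⟨fun k ↦ f (ns k), fun k ↦ hf _, hfu', hmem, (tendsto_eLpNorm_two_iff hfu').2 ?_,
    hzero⟩, ns, hns, hmem, (tendsto_eLpNorm_two_iff hmem).1 hzero⟩
  exact hfu.comp hns.tendsto_atTop

lemma integral_sub_sq_eq_dist_sq {α : Type*} [MeasurableSpace α] {μ : Measure α} {f g : α → ℝ}
    (hf : MemLp f 2 μ) (hg : MemLp g 2 μ) :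
    ∫ x, (f x - g x) ^ 2 ∂μ = dist (hf.toLp f) (hg.toLp g) ^ 2 := by
  rw [dist_edist, Lp.edist_toLp_toLp, eLpNorm_two_eq (hf.sub hg),
    ENNReal.toReal_ofReal (Real.sqrt_nonneg _), Real.sq_sqrt (integral_nonneg fun x ↦ sq_nonneg _)]
  rfl

/-- Rellich's theorem. -/
lemma exists_subseq_tendsto_of_bounded (hφ : Continuous φ) {f : ℕ → M → ℝ}
    (hf : ∀ k, ContMDiff I 𝓘(ℝ, ℝ) ∞ (f k)) {B : ℝ}
    (hB : ∀ k, ∫ x, f k x ^ 2 ∂weightedVolume I φ ≤ B)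
    (hB' : ∀ k, ∫ x, ‖gradient I (f k) x‖ ^ 2 ∂weightedVolume I φ ≤ B) :
    ∃ ns : ℕ → ℕ, StrictMono ns ∧ ∃ u : M → ℝ, MemLp u 2 (weightedVolume I φ) ∧
      Tendsto (fun k ↦ ∫ x, (f (ns k) x - u x) ^ 2 ∂weightedVolume I φ) atTop (𝓝 0) := by
  have hB0 : 0 ≤ B := (integral_nonneg fun x ↦ sq_nonneg (f 0 x)).trans (hB 0)
  have hf2 : ∀ k, MemLp (f k) 2 (weightedVolume I φ) := fun k ↦ memLp_of_smooth (hf k)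
  set F : ℕ → Lp ℝ 2 (weightedVolume I φ) := fun k ↦ (hf2 k).toLp (f k) with hF
  have hFint : ∀ k (A : Set M), ∫ x in A, F k x ∂weightedVolume I φ =
      ∫ x in A, f k x ∂weightedVolume I φ := fun k A ↦
    integral_congr_ae (ae_restrict_of_ae (hf2 k).coeFn_toLp)
  have hgrad : ∀ k l, ∫ x, ‖gradient I (fun x ↦ f k x - f l x) x‖ ^ 2 ∂weightedVolume I φ ≤
      4 * B := by
    intro k l
    calc _ ≤ ∫ x, (‖gradient I (f k) x‖ + ‖gradient I (f l) x‖) ^ 2 ∂weightedVolume I φ := by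
          refine integral_sq_mono
            ((memLp_norm_gradient (hf k)).add (memLp_norm_gradient (hf l))) fun x ↦ ?_
          rw [abs_norm, gradient_sub (mdifferentiable_of_smooth (hf k))
            (mdifferentiable_of_smooth (hf l))]
          exact norm_sub_le _ _
      _ ≤ _ := (integral_add_sq_le (memLp_norm_gradient (hf k))
          (memLp_norm_gradient (hf l))).trans (by linarith [hB' k, hB' l])
  -- Along an ultrafilter every bounded integral ∫_A f converges, whatever A is. The finitely many
  -- sets in the quantitative estimate can therefore depend on ε without any diagonal argument.
  have htb : TotallyBounded (range F) := by
    rw [totallyBounded_iff_ultrafilter]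
    intro U hU
    have hconv : ∀ A : Set M, ∃ c : ℝ,
        Tendsto (fun L : Lp ℝ 2 (weightedVolume I φ) ↦ ∫ x in A, L x ∂weightedVolume I φ) U
          (𝓝 c) := by
      intro A
      set R := Real.sqrt (B * (weightedVolume I φ).real univ)
      have hmem : ↑(U.map fun L : Lp ℝ 2 (weightedVolume I φ) ↦
          ∫ x in A, L x ∂weightedVolume I φ) ≤ 𝓟 (Icc (-R) R) := by
        refine tendsto_principal.2 ?_
        filter_upwards [le_principal_iff.1 hU]
        rintro _ ⟨k, rfl⟩
        rw [hFint, mem_Icc, ← abs_le]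
        refine Real.abs_le_sqrt ?_
        have h1 := sq_integral_mul_le ((hf2 k).restrict A)
          (memLp_const (1 : ℝ) (μ := (weightedVolume I φ).restrict A))
        simp only [mul_one, one_pow, integral_const, smul_eq_mul, measureReal_restrict_apply_univ]
          at h1
        refine h1.trans (mul_le_mul ?_ (measureReal_mono (subset_univ A)) measureReal_nonneg hB0)
        exact (setIntegral_le_integral (hf2 k).integrable_sq
          (ae_of_all _ fun x ↦ sq_nonneg _)).trans (hB k)
      obtain ⟨c, -, hc⟩ := isCompact_Icc.ultrafilter_le_nhds _ hmem
      exact ⟨c, hc⟩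
    choose c hc using hconv
    refine ⟨U.neBot, Metric.uniformity_basis_dist.ge_iff.2 fun ε hε ↦ ?_⟩
    -- Gradients of differences have energy at most 4B, so this choice makes the gradient term at
    -- most ε²/2; the finite sum of integrals takes the other half. The 1 in B + 1 allows B = 0.
    obtain ⟨T, C, hC, hT⟩ := exists_integral_sq_le I hφ
      (show 0 < ε ^ 2 / (8 * (B + 1)) by positivity)
    have hlim : Tendsto (fun p : Lp ℝ 2 (weightedVolume I φ) × Lp ℝ 2 (weightedVolume I φ) ↦
        C * ∑ A ∈ T, ((∫ x in A, p.1 x ∂weightedVolume I φ) -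
          ∫ x in A, p.2 x ∂weightedVolume I φ) ^ 2) (↑U ×ˢ ↑U) (𝓝 0) := by
      have h1 : ∀ A ∈ T, Tendsto
          (fun p : Lp ℝ 2 (weightedVolume I φ) × Lp ℝ 2 (weightedVolume I φ) ↦
            ((∫ x in A, p.1 x ∂weightedVolume I φ) - ∫ x in A, p.2 x ∂weightedVolume I φ) ^ 2)
          (↑U ×ˢ ↑U) (𝓝 ((c A - c A) ^ 2)) := fun A _ ↦
        (((hc A).comp tendsto_fst).sub ((hc A).comp tendsto_snd)).pow 2
      simpa using (tendsto_finsetSum T h1).const_mul C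
    have hrange : ∀ᶠ p : Lp ℝ 2 (weightedVolume I φ) × Lp ℝ 2 (weightedVolume I φ) in
        ↑U ×ˢ ↑U, p.1 ∈ range F ∧ p.2 ∈ range F :=
      (tendsto_fst.eventually (le_principal_iff.1 hU)).and
        (tendsto_snd.eventually (le_principal_iff.1 hU))
    filter_upwards [hlim.eventually (gt_mem_nhds (show 0 < ε ^ 2 / 2 by positivity)), hrange]
    rintro ⟨_, _⟩ hp ⟨⟨k, rfl⟩, ⟨l, rfl⟩⟩
    simp only [hFint] at hp
    have h1 := hT (fun x ↦ f k x - f l x) (contMDiff_one_of_smooth ((hf k).sub (hf l)))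
    simp only [integral_sub ((hf2 k).integrable (by norm_num)).integrableOn
      ((hf2 l).integrable (by norm_num)).integrableOn] at h1
    rw [integral_sub_sq_eq_dist_sq (hf2 k) (hf2 l)] at h1
    have h2 : ε ^ 2 / (8 * (B + 1)) *
        ∫ x, ‖gradient I (fun x ↦ f k x - f l x) x‖ ^ 2 ∂weightedVolume I φ ≤ ε ^ 2 / 2 := by
      calc _ ≤ ε ^ 2 / (8 * (B + 1)) * (4 * B) := by gcongr; exact hgrad k l
        _ ≤ ε ^ 2 / 2 := by
          rw [div_mul_eq_mul_div, div_le_div_iff₀ (by positivity) (by norm_num)]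
          nlinarith [sq_nonneg ε]
    have h3 : dist (F k) (F l) ^ 2 < ε ^ 2 := by
      have : ε ^ 2 / 2 + ε ^ 2 / 2 = ε ^ 2 := by ring
      simp only [hF]
      linarith
    exact lt_of_pow_lt_pow_left₀ 2 hε.le h3
  have hcomp : IsCompact (closure (range F)) :=
    isCompact_iff_totallyBounded_isComplete.2 ⟨htb.closure, isClosed_closure.isComplete⟩
  obtain ⟨L, -, ns, hns, hL⟩ := hcomp.tendsto_subseq fun k ↦ subset_closure (mem_range_self k)
  refine ⟨ns, hns, L, Lp.memLp L, ?_⟩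
  simp_rw [fun k ↦ integral_sub_sq_eq_dist_sq (hf2 (ns k)) (Lp.memLp L), Lp.toLp_coeFn]
  have := (tendsto_iff_dist_tendsto_zero.1 hL).pow 2
  simpa using this

end Compactness

/-! ### Rayleigh quotient, first eigenvalue and the global Poincaré inequality. -/

section Eigenvalue

variable {n : ℕ} {H : Type*} [TopologicalSpace H]
    {I : ModelWithCorners ℝ (EuclideanSpace ℝ (Fin n)) H}
    {M : Type*} [TopologicalSpace M] [ChartedSpace H M]

variable [RiemannianBundle (fun x : M ↦ TangentSpace I x)] [CompactSpace M] [MeasurableSpace M]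
  [BorelSpace M] {φ : M → ℝ} [IsFiniteMeasure (weightedVolume I φ)]

/-- Test the weak equation with the eigenfunction itself: ∫|∇u|² = λ∫u² with ∫u² > 0. -/
lemma IsEigenvalue.nonneg {lam : ℝ} (h : IsEigenvalue I φ lam) : 0 ≤ lam := by
  obtain ⟨u, hu0, -, X, hX, hweak⟩ := h
  have h1 := hweak u X hX
  have h2 : ∫ x, inner ℝ (X x) (X x) ∂weightedVolume I φ =
      ∫ x, ‖X x‖ ^ 2 ∂weightedVolume I φ :=
    integral_congr_ae (ae_of_all _ fun x ↦ real_inner_self_eq_norm_sq _)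
  have h3 : ∫ x, lam * u x * u x ∂weightedVolume I φ =
      lam * ∫ x, u x ^ 2 ∂weightedVolume I φ := by
    rw [← integral_const_mul]
    refine integral_congr_ae (ae_of_all _ fun x ↦ ?_)
    ring
  rw [h2, h3] at h1
  have h4 : 0 < ∫ x, u x ^ 2 ∂weightedVolume I φ := by
    refine lt_of_le_of_ne (integral_nonneg fun x ↦ sq_nonneg _) fun h0 ↦ hu0 ?_
    have := (integral_eq_zero_iff_of_nonneg (fun x ↦ sq_nonneg (u x)) hX.memLp.integrable_sq).1
      h0.symm
    filter_upwards [this] with x hx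
    simpa using hx
  have h5 : 0 ≤ ∫ x, ‖X x‖ ^ 2 ∂weightedVolume I φ := integral_nonneg fun x ↦ sq_nonneg _
  rw [h1] at h5
  exact nonneg_of_mul_nonneg_left h5 h4

/-- This includes the case of no nonzero eigenvalue, where the infimum of the empty set is 0 by
convention. -/
lemma firstEigenvalue_nonneg : 0 ≤ firstEigenvalue I φ :=
  Real.sInf_nonneg fun _ h ↦ h.2.nonneg

lemma firstEigenvalue_le {lam : ℝ} (h0 : lam ≠ 0) (h : IsEigenvalue I φ lam) :
    firstEigenvalue I φ ≤ lam :=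
  csInf_le ⟨0, fun _ h ↦ h.2.nonneg⟩ ⟨h0, h⟩

variable [IsManifold I 1 M]
  [IsContMDiffRiemannianBundle I 0 (EuclideanSpace ℝ (Fin n)) (fun x : M ↦ TangentSpace I x)]

/-- Apply the local Poincaré inequality to smooth approximants, whose energies tend to 0. The
constants it produces need not be shown to converge: by minimality the mean of u does at least as
well as each of them. -/
lemma HasGradient.exists_mem_nhds_ae_eq_const (hφ : Continuous φ) {u : M → ℝ}
    {X : (x : M) → TangentSpace I x} (h : HasGradient I φ u X)
    (hX : ∫ x, ‖X x‖ ^ 2 ∂weightedVolume I φ = 0) (x₀ : M) :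
    ∃ P ∈ 𝓝 x₀, ∃ c : ℝ, ∀ᵐ x ∂weightedVolume I φ, x ∈ P → u x = c := by
  obtain ⟨P, hP, hPm, ⟨C, hC⟩, -⟩ := exists_local_estimates I hφ x₀
  obtain ⟨f, hf, f1, f2, f3, f4⟩ := h.exists_approx
  have hgrad : Tendsto (fun k ↦ ∫ x, ‖gradient I (f k) x‖ ^ 2 ∂weightedVolume I φ) atTop
      (𝓝 0) := by
    rw [← hX]
    exact tendsto_integral_sq_of_abs_sub_le (fun k ↦ memLp_norm_gradient (hf k)) h.memLp_norm f2
      (fun k x ↦ abs_norm_sub_norm_le _ _) f4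
  choose c hc using fun k ↦ hC (f k) (contMDiff_one_of_smooth (hf k))
  set m := (∫ x in P, u x ∂weightedVolume I φ) / (weightedVolume I φ).real P with hm
  have hu := h.memLp
  have hum : MemLp (fun x ↦ u x - m) 2 (weightedVolume I φ) := hu.sub (memLp_const m)
  have hmean : (∫ x in P, (u x - m) ∂weightedVolume I φ) ^ 2 / (weightedVolume I φ).real P = 0 := by
    rw [integral_sub (hu.integrable (by norm_num)).integrableOn (integrable_const m),
      setIntegral_const, smul_eq_mul]
    by_cases h0 : (weightedVolume I φ).real P = 0
    · simp [h0]
    · have : (∫ x in P, u x ∂weightedVolume I φ) - (weightedVolume I φ).real P * m = 0 := by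
        rw [hm]
        field_simp
        ring
      rw [this]
      simp
  have hle : ∀ k, ∫ x in P, (u x - m) ^ 2 ∂weightedVolume I φ ≤
      2 * ∫ x, (f k x - u x) ^ 2 ∂weightedVolume I φ +
        2 * (|C| * ∫ x, ‖gradient I (f k) x‖ ^ 2 ∂weightedVolume I φ) := by
    intro k
    have h1 := setIntegral_sq_le hum P (c k - m)
    rw [hmean, add_zero] at h1
    have h2 := integral_add_sq_le (μ := (weightedVolume I φ).restrict P)
      (((f1 k).neg).restrict P)
      (((memLp_of_smooth (hf k)).sub (memLp_const (c k))).restrict P)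
    refine h1.trans ((le_of_eq ?_).trans (h2.trans (add_le_add ?_ ?_)))
    · refine integral_congr_ae (ae_of_all _ fun x ↦ ?_)
      simp only [Pi.neg_apply, Pi.sub_apply]
      ring
    · simp only [Pi.neg_apply, neg_sq]
      exact mul_le_mul_of_nonneg_left (setIntegral_le_integral (f1 k).integrable_sq
        (ae_of_all _ fun x ↦ sq_nonneg _)) (by norm_num)
    · refine mul_le_mul_of_nonneg_left ((hc k).trans ?_) (by norm_num)
      refine mul_le_mul (le_abs_self C) (setIntegral_le_integral
        (memLp_norm_gradient (hf k)).integrable_sq (ae_of_all _ fun x ↦ sq_nonneg _))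
        (integral_nonneg fun x ↦ sq_nonneg _) (abs_nonneg _)
  have hlim : Tendsto (fun k ↦ 2 * ∫ x, (f k x - u x) ^ 2 ∂weightedVolume I φ +
        2 * (|C| * ∫ x, ‖gradient I (f k) x‖ ^ 2 ∂weightedVolume I φ)) atTop (𝓝 0) := by
    simpa using (f3.const_mul 2).add ((hgrad.const_mul |C|).const_mul 2)
  have hzero : ∫ x in P, (u x - m) ^ 2 ∂weightedVolume I φ = 0 :=
    le_antisymm (ge_of_tendsto' hlim hle) (integral_nonneg fun x ↦ sq_nonneg _)
  refine ⟨P, hP, m, ?_⟩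
  rw [integral_eq_zero_iff_of_nonneg (fun x ↦ sq_nonneg _) (hum.restrict P).integrable_sq] at hzero
  filter_upwards [(ae_restrict_iff' hPm).1 hzero] with x hx hxP
  have := hx hxP
  simpa [sub_eq_zero] using this

/-- On a connected manifold, functions with vanishing gradient are constant. -/
lemma HasGradient.ae_eq_const [PreconnectedSpace M] (hφ : Continuous φ) {u : M → ℝ}
    {X : (x : M) → TangentSpace I x} (h : HasGradient I φ u X)
    (hX : ∫ x, ‖X x‖ ^ 2 ∂weightedVolume I φ = 0) :
    ∃ c : ℝ, ∀ᵐ x ∂weightedVolume I φ, u x = c := by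
  rcases isEmpty_or_nonempty M with hM | ⟨⟨x₁⟩⟩
  · exact ⟨0, ae_of_all _ fun x ↦ (hM.false x).elim⟩
  choose P hP c hc using h.exists_mem_nhds_ae_eq_const hφ hX
  -- Where the interiors of two neighbourhoods meet, they meet in a nonempty open set. It has
  -- positive volume, so it contains a point at which u equals both constants.
  have hloc : IsLocallyConstant c := by
    rw [IsLocallyConstant.iff_eventually_eq]
    intro x
    filter_upwards [interior_mem_nhds.2 (hP x)] with y hy
    have hU : IsOpen (interior (P x) ∩ interior (P y)) := isOpen_interior.inter isOpen_interior
    have hne : (interior (P x) ∩ interior (P y)).Nonempty :=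
      ⟨y, hy, mem_interior_iff_mem_nhds.2 (hP y)⟩
    by_contra hcon
    refine weightedVolume_pos_of_isOpen (I := I) hφ hU hne (measure_eq_zero_iff_ae_notMem.2 ?_)
    filter_upwards [hc x, hc y] with z hzx hzy hz
    exact hcon ((hzy (interior_subset hz.2)).symm.trans (hzx (interior_subset hz.1)))
  obtain ⟨t, -, ht⟩ := isCompact_univ.elim_nhds_subcover P fun x _ ↦ hP x
  refine ⟨c x₁, ?_⟩
  have hall : ∀ᵐ x ∂weightedVolume I φ, ∀ y ∈ t, x ∈ P y → u x = c y :=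
    (ae_ball_iff t.countable_toSet).2 fun y _ ↦ hc y
  filter_upwards [hall] with x hx
  obtain ⟨y, hy, hxy⟩ := mem_iUnion₂.1 (ht (mem_univ x))
  rw [hx y hy hxy]
  exact hloc.apply_eq_of_preconnectedSpace y x₁

/-- A Poincaré inequality for smooth functions extends to `H¹(M)`. -/
lemma HasGradient.poincare_of_smooth {lam : ℝ}
    (hlam : ∀ f : M → ℝ, ContMDiff I 𝓘(ℝ, ℝ) ∞ f →
      lam * (∫ x, f x ^ 2 ∂weightedVolume I φ -
        (∫ x, f x ∂weightedVolume I φ) ^ 2 / (weightedVolume I φ).real univ) ≤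
      ∫ x, ‖gradient I f x‖ ^ 2 ∂weightedVolume I φ)
    {u : M → ℝ} {X : (x : M) → TangentSpace I x} (h : HasGradient I φ u X) :
    lam * (∫ x, u x ^ 2 ∂weightedVolume I φ -
        (∫ x, u x ∂weightedVolume I φ) ^ 2 / (weightedVolume I φ).real univ) ≤
      ∫ x, ‖X x‖ ^ 2 ∂weightedVolume I φ := by
  obtain ⟨f, hf, f1, f2, f3, f4⟩ := h.exists_approx
  have hgrad := tendsto_integral_sq_of_abs_sub_le (fun k ↦ memLp_norm_gradient (hf k))
    h.memLp_norm f2 (fun k x ↦ abs_norm_sub_norm_le _ _) f4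
  have hsq := tendsto_integral_sq_of_abs_sub_le (r := fun k x ↦ |f k x - u x|)
    (fun k ↦ memLp_of_smooth (hf k)) h.memLp (fun k ↦ (f1 k).abs) (fun k x ↦ le_rfl)
    (by simpa using f3)
  have hint := tendsto_integral_of_tendsto_sq (fun k ↦ memLp_of_smooth (hf k)) h.memLp f3
  exact le_of_tendsto_of_tendsto' ((hsq.sub ((hint.pow 2).div_const _)).const_mul lam) hgrad
    fun k ↦ hlam (f k) (hf k)

/-- A normalized extremal of a Poincaré inequality is an eigenfunction. -/
lemma HasGradient.isEigenvalue_of_extremal {lam : ℝ}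
    (hlam : ∀ (v : M → ℝ) (Y : (x : M) → TangentSpace I x), HasGradient I φ v Y →
      lam * (∫ x, v x ^ 2 ∂weightedVolume I φ -
        (∫ x, v x ∂weightedVolume I φ) ^ 2 / (weightedVolume I φ).real univ) ≤
      ∫ x, ‖Y x‖ ^ 2 ∂weightedVolume I φ)
    {u : M → ℝ} {X : (x : M) → TangentSpace I x} (h : HasGradient I φ u X)
    (hu0 : ∫ x, u x ∂weightedVolume I φ = 0) (hu1 : ∫ x, u x ^ 2 ∂weightedVolume I φ = 1)
    (hX : ∫ x, ‖X x‖ ^ 2 ∂weightedVolume I φ ≤ lam) : IsEigenvalue I φ lam := by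
  refine ⟨u, fun h0 ↦ ?_, h.memLp.const_mul lam, X, h, fun v Y hv ↦ ?_⟩
  · have : ∫ x, u x ^ 2 ∂weightedVolume I φ = 0 := by
      rw [integral_eq_zero_of_ae]
      filter_upwards [h0] with x hx
      simp [hx]
    linarith
  set V := (weightedVolume I φ).real univ
  set a := ∫ x, inner ℝ (X x) (Y x) ∂weightedVolume I φ
  set b := ∫ x, u x * v x ∂weightedVolume I φ with hb
  set D := ∫ x, ‖Y x‖ ^ 2 ∂weightedVolume I φ
  set N := ∫ x, v x ^ 2 ∂weightedVolume I φ
  set S := ∫ x, v x ∂weightedVolume I φ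
  have hrhs : ∫ x, lam * u x * v x ∂weightedVolume I φ = lam * b := by
    rw [hb, ← integral_const_mul]
    refine integral_congr_ae (ae_of_all _ fun x ↦ ?_)
    ring
  rw [hrhs]
  have huv : Integrable (fun x ↦ u x * v x) (weightedVolume I φ) :=
    h.memLp.integrable_mul hv.memLp
  -- The first variation at u + tv. The constant term ∫|X|² - λ is at most 0 and can be replaced by
  -- 0, which forces the linear coefficient to vanish. Since the inequality is written with the
  -- variance, v need not have mean zero.
  have key : ∀ t : ℝ, 0 ≤ (D - lam * (N - S ^ 2 / V)) * (t * t) + 2 * (a - lam * b) * t + 0 := by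
    intro t
    have h1 := hlam _ _ (h.add (hv.const_mul t))
    rw [h.integral_norm_add_smul_sq hv t] at h1
    have h2 : ∫ x, (u x + t * v x) ^ 2 ∂weightedVolume I φ = 1 + 2 * t * b + t ^ 2 * N := by
      have : ∀ x, (u x + t * v x) ^ 2 = u x ^ 2 + 2 * t * (u x * v x) + t ^ 2 * v x ^ 2 :=
        fun x ↦ by ring
      rw [integral_congr_ae (ae_of_all _ this), integral_add_const_mul_add_const_mul
        h.memLp.integrable_sq huv hv.memLp.integrable_sq, hu1]
    have h3 : ∫ x, (u x + t * v x) ∂weightedVolume I φ = t * S := by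
      rw [integral_add (h.memLp.integrable (by norm_num))
        ((hv.memLp.integrable (by norm_num)).const_mul t), hu0, zero_add, integral_const_mul]
    rw [h2, h3] at h1
    have h4 : (t * S) ^ 2 / V = t ^ 2 * (S ^ 2 / V) := by ring
    rw [h4] at h1
    nlinarith
  have hd := discrim_le_zero key
  rw [discrim] at hd
  have : a - lam * b = 0 := by
    have h5 : (a - lam * b) ^ 2 ≤ 0 := by nlinarith
    exact pow_eq_zero_iff two_ne_zero |>.1 (le_antisymm h5 (sq_nonneg _))
  linarith

/-- The Poincaré inequality with the first nonzero eigenvalue. -/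
theorem HasGradient.firstEigenvalue_mul_le [PreconnectedSpace M] (hφ : Continuous φ) {u : M → ℝ}
    {X : (x : M) → TangentSpace I x} (h : HasGradient I φ u X)
    (hu : ∫ x, u x ∂weightedVolume I φ = 0) :
    firstEigenvalue I φ * ∫ x, u x ^ 2 ∂weightedVolume I φ ≤
      ∫ x, ‖X x‖ ^ 2 ∂weightedVolume I φ := by
  set μ := weightedVolume I φ with hμ
  set S : Set ℝ := {r | ∃ f : M → ℝ, ContMDiff I 𝓘(ℝ, ℝ) ∞ f ∧ ∫ x, f x ∂μ = 0 ∧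
    ∫ x, f x ^ 2 ∂μ = 1 ∧ r = ∫ x, ‖gradient I f x‖ ^ 2 ∂μ} with hS
  have hD0 : 0 ≤ ∫ x, ‖X x‖ ^ 2 ∂μ := integral_nonneg fun x ↦ sq_nonneg _
  by_cases hV : μ.real univ = 0
  · have : μ = 0 := by
      rw [← Measure.measure_univ_eq_zero, ← measureReal_eq_zero_iff]
      exact hV
    simp [this]
  have hVpos : 0 < μ.real univ := lt_of_le_of_ne measureReal_nonneg (Ne.symm hV)
  -- Every smooth function of positive variance gives an element of `S`.
  have hnorm : ∀ f : M → ℝ, ContMDiff I 𝓘(ℝ, ℝ) ∞ f →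
      0 < ∫ x, f x ^ 2 ∂μ - (∫ x, f x ∂μ) ^ 2 / μ.real univ →
      (∫ x, ‖gradient I f x‖ ^ 2 ∂μ) / (∫ x, f x ^ 2 ∂μ - (∫ x, f x ∂μ) ^ 2 / μ.real univ)
        ∈ S := by
    intro f hf hpos
    set q := ∫ x, f x ^ 2 ∂μ - (∫ x, f x ∂μ) ^ 2 / μ.real univ with hq
    set m := (∫ x, f x ∂μ) / μ.real univ with hm
    have hs : (Real.sqrt q)⁻¹ ^ 2 = q⁻¹ := by rw [inv_pow, Real.sq_sqrt hpos.le]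
    have hfm : ContMDiff I 𝓘(ℝ, ℝ) ∞ (fun x ↦ f x - m) := hf.sub contMDiff_const
    have hf2 : MemLp f 2 μ := memLp_of_smooth hf
    refine ⟨fun x ↦ (Real.sqrt q)⁻¹ * (f x - m), contMDiff_const.mul hfm, ?_, ?_, ?_⟩
    · rw [integral_const_mul, integral_sub (hf2.integrable (by norm_num)) (integrable_const m),
        integral_const, smul_eq_mul, hm, mul_div_cancel₀ _ hV, sub_self, mul_zero]
    · simp_rw [mul_pow]
      rw [integral_const_mul, integral_sub_mean_sq hf2 hV, ← hq, hs, inv_mul_cancel₀ hpos.ne']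
    · have h1 : ∀ x, ‖gradient I (fun x ↦ (Real.sqrt q)⁻¹ * (f x - m)) x‖ ^ 2 =
          q⁻¹ * ‖gradient I f x‖ ^ 2 := fun x ↦ by
        rw [gradient_const_mul _ (mdifferentiable_of_smooth hfm),
          gradient_sub (mdifferentiable_of_smooth hf) (mdifferentiable_of_smooth contMDiff_const),
          gradient_const, sub_zero, norm_smul, mul_pow, Real.norm_eq_abs, sq_abs, hs]
      rw [integral_congr_ae (ae_of_all _ h1), integral_const_mul]
      exact div_eq_inv_mul _ _
  have hSbdd : BddBelow S := ⟨0, by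
    rintro _ ⟨f, -, -, -, rfl⟩
    exact integral_nonneg fun x ↦ sq_nonneg _⟩
  -- The optimal Poincaré inequality.
  have hsmooth : ∀ lam : ℝ, (∀ r ∈ S, lam ≤ r) → ∀ (v : M → ℝ) (Y : (x : M) → TangentSpace I x),
      HasGradient I φ v Y →
      lam * (∫ x, v x ^ 2 ∂μ - (∫ x, v x ∂μ) ^ 2 / μ.real univ) ≤ ∫ x, ‖Y x‖ ^ 2 ∂μ := by
    intro lam hlam v Y hv
    refine HasGradient.poincare_of_smooth (fun f hf ↦ ?_) hv
    have hq0 : 0 ≤ ∫ x, f x ^ 2 ∂μ - (∫ x, f x ∂μ) ^ 2 / μ.real univ := by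
      rw [← integral_sub_mean_sq (memLp_of_smooth hf) hV]
      exact integral_nonneg fun x ↦ sq_nonneg _
    rcases hq0.eq_or_lt with hq | hq
    · rw [← hq, mul_zero]
      exact integral_nonneg fun x ↦ sq_nonneg _
    · exact (le_div_iff₀ hq).1 (hlam _ (hnorm f hf hq))
  -- If `S` is empty, no smooth function has positive variance (as when the manifold is a point),
  -- and the Poincaré inequality holds with any constant.
  rcases S.eq_empty_or_nonempty with hSe | hSne
  · have h1 := hsmooth (firstEigenvalue I φ) (by simp [hSe]) u X h
    simpa [hu] using h1
  set lam := sInf S with hlam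
  have hpoin := hsmooth lam fun r hr ↦ csInf_le hSbdd hr
  have hlam0 : 0 ≤ lam := Real.sInf_nonneg fun r ⟨f, _, _, _, hr⟩ ↦
    hr ▸ integral_nonneg fun x ↦ sq_nonneg _
  -- A minimizing sequence.
  have hex : ∀ k : ℕ, ∃ f : M → ℝ, ContMDiff I 𝓘(ℝ, ℝ) ∞ f ∧ ∫ x, f x ∂μ = 0 ∧
      ∫ x, f x ^ 2 ∂μ = 1 ∧ ∫ x, ‖gradient I f x‖ ^ 2 ∂μ < lam + 1 / (k + 1) := by
    intro k
    obtain ⟨_, ⟨f, hf, hf0, hf1, rfl⟩, hlt⟩ := exists_lt_of_csInf_lt hSne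
      (show sInf S < lam + 1 / (k + 1) by
        have : (0 : ℝ) < 1 / (k + 1) := by positivity
        linarith)
    exact ⟨f, hf, hf0, hf1, hlt⟩
  choose g hg hg0 hg1 hglt using hex
  obtain ⟨ns, hns, w, hw, hgw⟩ := exists_subseq_tendsto_of_bounded (B := lam + 1) hφ hg
    (fun k ↦ by rw [hg1]; linarith) fun k ↦ (hglt k).le.trans (by
      have : (1 : ℝ) / (k + 1) ≤ 1 := by
        rw [div_le_one (by positivity)]
        linarith [(Nat.cast_nonneg k : (0 : ℝ) ≤ k)]
      linarith)
  have hδ : Tendsto (fun k : ℕ ↦ (1 : ℝ) / (ns k + 1)) atTop (𝓝 0) :=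
    tendsto_one_div_add_atTop_nhds_zero_nat.comp hns.tendsto_atTop
  -- Parallelogram law: |∇(gₖ - gₗ)|² = 2|∇gₖ|² + 2|∇gₗ|² - |∇(gₖ + gₗ)|² after integration, and the
  -- last energy is at least λ∫(gₖ + gₗ)² = λ(4 - ∫(gₖ - gₗ)²). Near-minimality leaves only the
  -- errors and an L² distance, which is measured through w.
  have hpar : ∀ k l, ∫ x, ‖gradient I (g (ns k)) x - gradient I (g (ns l)) x‖ ^ 2 ∂μ ≤
      2 * (1 / (ns k + 1)) + 2 * (1 / (ns l + 1)) + lam * (2 * ∫ x, (g (ns k) x - w x) ^ 2 ∂μ +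
        2 * ∫ x, (g (ns l) x - w x) ^ 2 ∂μ) := by
    intro k l
    have hk := HasGradient.of_smooth φ (hg (ns k))
    have hl := HasGradient.of_smooth φ (hg (ns l))
    have e1 := hk.integral_norm_add_smul_sq hl 1
    have e2 := hk.integral_norm_add_smul_sq hl (-1)
    simp only [one_smul, neg_smul, ← sub_eq_add_neg] at e1 e2
    have e3 := hpoin _ _ (hk.add hl)
    have hint : ∫ x, (g (ns k) x + g (ns l) x) ∂μ = 0 := by
      rw [integral_add (hk.memLp.integrable (by norm_num)) (hl.memLp.integrable (by norm_num)),
        hg0, hg0, add_zero]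
    have hkl : Integrable (fun x ↦ g (ns k) x * g (ns l) x) μ := hk.memLp.integrable_mul hl.memLp
    have hplus : ∫ x, (g (ns k) x + g (ns l) x) ^ 2 ∂μ =
        2 + 2 * ∫ x, g (ns k) x * g (ns l) x ∂μ := by
      have : ∀ x, (g (ns k) x + g (ns l) x) ^ 2 =
          g (ns k) x ^ 2 + 2 * (g (ns k) x * g (ns l) x) + 1 * g (ns l) x ^ 2 := fun x ↦ by ring
      rw [integral_congr_ae (ae_of_all _ this), integral_add_const_mul_add_const_mul
        hk.memLp.integrable_sq hkl hl.memLp.integrable_sq, hg1, hg1]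
      ring
    have hminus : ∫ x, (g (ns k) x - g (ns l) x) ^ 2 ∂μ =
        2 - 2 * ∫ x, g (ns k) x * g (ns l) x ∂μ := by
      have : ∀ x, (g (ns k) x - g (ns l) x) ^ 2 =
          g (ns k) x ^ 2 + (-2) * (g (ns k) x * g (ns l) x) + 1 * g (ns l) x ^ 2 :=
        fun x ↦ by ring
      rw [integral_congr_ae (ae_of_all _ this), integral_add_const_mul_add_const_mul
        hk.memLp.integrable_sq hkl hl.memLp.integrable_sq, hg1, hg1]
      ring
    have hle : ∫ x, (g (ns k) x - g (ns l) x) ^ 2 ∂μ ≤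
        2 * ∫ x, (g (ns k) x - w x) ^ 2 ∂μ + 2 * ∫ x, (g (ns l) x - w x) ^ 2 ∂μ := by
      have h1 := integral_add_sq_le (hk.memLp.sub hw) (hw.sub hl.memLp)
      have h2 : ∫ x, (w x - g (ns l) x) ^ 2 ∂μ = ∫ x, (g (ns l) x - w x) ^ 2 ∂μ :=
        integral_congr_ae (ae_of_all _ fun x ↦ sub_sq_comm _ _)
      simp only [Pi.sub_apply, sub_add_sub_cancel] at h1
      rwa [h2] at h1
    rw [hint, hplus, zero_pow two_ne_zero, zero_div, sub_zero] at e3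
    rw [hminus] at hle
    have hle' := mul_le_mul_of_nonneg_left hle hlam0
    have hk' := hglt (ns k)
    have hl' := hglt (ns l)
    linarith
  obtain ⟨Z, hZ, ms, hms, hZmem, hZlim⟩ := exists_hasGradient_of_cauchy
    (f := fun k ↦ g (ns k)) (fun k ↦ hg _) hw hgw (by
      intro ε hε
      have ht : Tendsto (fun k ↦ 2 * ((1 : ℝ) / (ns k + 1)) +
          lam * (2 * ∫ x, (g (ns k) x - w x) ^ 2 ∂μ)) atTop (𝓝 0) := by
        simpa using (hδ.const_mul 2).add ((hgw.const_mul 2).const_mul lam)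
      have hev := ht.eventually (gt_mem_nhds (half_pos hε))
      obtain ⟨N, hN⟩ := eventually_atTop.1 hev
      filter_upwards [eventually_ge_atTop N] with k hk l hl
      have h1 := hN k hk
      have h2 := hN l (hk.trans hl)
      have h3 := hpar k l
      linarith)
  have hw0 : ∫ x, w x ∂μ = 0 := by
    have h1 : Tendsto (fun k ↦ ∫ x, g (ns k) x ∂μ) atTop (𝓝 (∫ x, w x ∂μ)) :=
      tendsto_integral_of_tendsto_sq (fun k ↦ memLp_of_smooth (hg (ns k))) hw hgw
    simp only [hg0] at h1
    exact tendsto_nhds_unique h1 tendsto_const_nhds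
  have hw1 : ∫ x, w x ^ 2 ∂μ = 1 := by
    have h1 : Tendsto (fun k ↦ ∫ x, g (ns k) x ^ 2 ∂μ) atTop (𝓝 (∫ x, w x ^ 2 ∂μ)) :=
      tendsto_integral_sq_of_abs_sub_le (r := fun k x ↦ |g (ns k) x - w x|)
      (fun k ↦ memLp_of_smooth (hg (ns k))) hw
      (fun k ↦ ((memLp_of_smooth (hg (ns k))).sub hw).abs) (fun k x ↦ le_rfl) (by simpa using hgw)
    simp only [hg1] at h1
    exact tendsto_nhds_unique h1 tendsto_const_nhds
  have hZle : ∫ x, ‖Z x‖ ^ 2 ∂μ ≤ lam := by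
    have h1 := tendsto_integral_sq_of_abs_sub_le
      (fun k ↦ memLp_norm_gradient (hg (ns (ms k)))) hZ.memLp_norm hZmem
      (fun k x ↦ abs_norm_sub_norm_le _ _) hZlim
    have h2 : Tendsto (fun k ↦ lam + (1 : ℝ) / (ns (ms k) + 1)) atTop (𝓝 lam) := by
      simpa using (hδ.comp hms.tendsto_atTop).const_add lam
    exact le_of_tendsto_of_tendsto' h1 h2 fun k ↦ (hglt _).le
  have heig : IsEigenvalue I φ lam := hZ.isEigenvalue_of_extremal hpoin hw0 hw1 hZle
  -- Connectedness enters here: at minimum 0 the limit w would be constant with mean zero,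
  -- contradicting ∫w² = 1.
  have hne : lam ≠ 0 := by
    intro h0
    have hZ0 : ∫ x, ‖Z x‖ ^ 2 ∂μ = 0 :=
      le_antisymm (hZle.trans_eq h0) (integral_nonneg fun x ↦ sq_nonneg _)
    obtain ⟨c, hc⟩ := hZ.ae_eq_const hφ hZ0
    have h1 : ∫ x, w x ∂μ = μ.real univ * c := by
      rw [integral_congr_ae hc, integral_const, smul_eq_mul]
    have h2 : c = 0 := by
      rw [hw0] at h1
      exact (mul_eq_zero.1 h1.symm).resolve_left hV
    have h3 : ∫ x, w x ^ 2 ∂μ = 0 := by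
      rw [integral_eq_zero_of_ae]
      filter_upwards [hc] with x hx
      simp [hx, h2]
    linarith
  have h1 := hpoin u X h
  rw [hu, zero_pow two_ne_zero, zero_div, sub_zero] at h1
  refine le_trans (mul_le_mul_of_nonneg_right (firstEigenvalue_le hne heig)
    (integral_nonneg fun x ↦ sq_nonneg _)) h1

end Eigenvalue

/-! ### Interpolation and the derivation of Nash's inequality. -/

section Nash

/-- Interpolation of the `L²` norm between `L¹` and `Lᵖ`, `p = 2ν/(ν-2)`. -/
lemma integral_sq_le_interpolation {α : Type*} [MeasurableSpace α] {μ : Measure α} {ν : ℝ}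
    (hν : 2 < ν) {u : α → ℝ} (hu : Integrable u μ) (hu2 : Integrable (fun x ↦ u x ^ 2) μ)
    (hup : Integrable (fun x ↦ |u x| ^ (2 * ν / (ν - 2))) μ) :
    (∫ x, u x ^ 2 ∂μ) ^ ((2 + ν) / ν) ≤
      (∫ x, |u x| ^ (2 * ν / (ν - 2)) ∂μ) ^ ((ν - 2) / ν) * (∫ x, |u x| ∂μ) ^ (4 / ν) := by
  have hν0 : 0 < ν := by linarith
  have hν2 : 0 < ν - 2 := by linarith
  set p := 2 * ν / (ν - 2) with hp
  -- The Hölder weights are determined by θ + η = 1 and pθ + η = 2. Raising to the power (2 + ν)/ν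
  -- afterwards turns them into (ν - 2)/ν and 4/ν.
  set θ := (ν - 2) / (ν + 2) with hθ
  set η := 4 / (ν + 2) with hη
  have hθ0 : 0 ≤ θ := by positivity
  have hη0 : 0 ≤ η := by positivity
  have hsum : θ + η = 1 := by
    rw [hθ, hη]
    field_simp
    ring
  have hpθ : p * θ + η = 2 := by
    rw [hp, hθ, hη]
    field_simp
    ring
  have hc0 : 0 ≤ ∫ x, |u x| ^ p ∂μ := integral_nonneg fun x ↦ by positivity
  have hb0 : 0 ≤ ∫ x, |u x| ∂μ := integral_nonneg fun x ↦ abs_nonneg _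
  have ha0 : 0 ≤ ∫ x, u x ^ 2 ∂μ := integral_nonneg fun x ↦ sq_nonneg _
  have hH := ENNReal.lintegral_mul_norm_pow_le (μ := μ)
    (f := fun x ↦ ENNReal.ofReal (|u x| ^ p)) (g := fun x ↦ ENNReal.ofReal |u x|)
    hup.1.aemeasurable.ennreal_ofReal hu.abs.1.aemeasurable.ennreal_ofReal hθ0 hη0 hsum
  have hpt : ∀ x, ENNReal.ofReal (|u x| ^ p) ^ θ * ENNReal.ofReal |u x| ^ η =
      ENNReal.ofReal (u x ^ 2) := by
    intro x
    rw [ENNReal.ofReal_rpow_of_nonneg (by positivity) hθ0,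
      ENNReal.ofReal_rpow_of_nonneg (abs_nonneg _) hη0, ← ENNReal.ofReal_mul (by positivity),
      ← Real.rpow_mul (abs_nonneg _), ← Real.rpow_add_of_nonneg (abs_nonneg _) (by positivity) hη0,
      hpθ, Real.rpow_two, sq_abs]
  simp_rw [hpt] at hH
  rw [← ofReal_integral_eq_lintegral_ofReal hu2 (ae_of_all _ fun x ↦ sq_nonneg _),
    ← ofReal_integral_eq_lintegral_ofReal hup (ae_of_all _ fun x ↦ by positivity),
    ← ofReal_integral_eq_lintegral_ofReal hu.abs (ae_of_all _ fun x ↦ abs_nonneg _),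
    ENNReal.ofReal_rpow_of_nonneg hc0 hθ0, ENNReal.ofReal_rpow_of_nonneg hb0 hη0,
    ← ENNReal.ofReal_mul (by positivity), ENNReal.ofReal_le_ofReal_iff (by positivity)] at hH
  calc (∫ x, u x ^ 2 ∂μ) ^ ((2 + ν) / ν)
      ≤ ((∫ x, |u x| ^ p ∂μ) ^ θ * (∫ x, |u x| ∂μ) ^ η) ^ ((2 + ν) / ν) := by gcongr
    _ = _ := by
      rw [Real.mul_rpow (by positivity) (by positivity), ← Real.rpow_mul hc0, ← Real.rpow_mul hb0]
      congr 2
      · rw [hθ]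
        field_simp
        ring
      · rw [hη]
        field_simp
        ring

/-- The Nash inequality from interpolation, a Sobolev inequality and a Poincaré inequality:
the algebra. -/
lemma nash_of_sobolev_of_poincare {ν α C₀ L V D a b c : ℝ} (hν : 2 < ν) (hC₀ : 0 < C₀)
    (hL : 0 ≤ L) (hV : 0 < V) (hα : 0 < α) (hD : 0 ≤ D) (hb : 0 ≤ b)
    (hint : a ^ ((2 + ν) / ν) ≤ c ^ ((ν - 2) / ν) * b ^ (4 / ν))
    (hsob : c ^ ((ν - 2) / ν) ≤ C₀ * V ^ (-(2 / ν)) * (D + α * a)) (hpoin : L * a ≤ D) :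
    L * V ^ (2 / ν) / (C₀ * (L + α)) * a ^ ((2 + ν) / ν) * b ^ (-(4 / ν)) ≤ D := by
  have hν0 : 0 < ν := by linarith
  have hLα : 0 < L + α := by linarith
  -- For b = 0 the real power 0^{-4/ν} is 0, which agrees with reading the right-hand side as 0.
  rcases hb.eq_or_lt with hb0 | hbpos
  · have h1 : b ^ (-(4 / ν)) = 0 := by
      rw [← hb0, Real.zero_rpow]
      have : 0 < 4 / ν := by positivity
      linarith
    rw [h1, mul_zero]
    exact hD
  have h1 : a ^ ((2 + ν) / ν) * b ^ (-(4 / ν)) ≤ c ^ ((ν - 2) / ν) := by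
    rw [Real.rpow_neg hb, ← div_eq_mul_inv, div_le_iff₀ (by positivity)]
    exact hint
  have h2 : V ^ (2 / ν) * V ^ (-(2 / ν)) = 1 := by
    rw [← Real.rpow_add hV, add_neg_cancel, Real.rpow_zero]
  calc L * V ^ (2 / ν) / (C₀ * (L + α)) * a ^ ((2 + ν) / ν) * b ^ (-(4 / ν))
      = L * V ^ (2 / ν) / (C₀ * (L + α)) * (a ^ ((2 + ν) / ν) * b ^ (-(4 / ν))) := by ring
    _ ≤ L * V ^ (2 / ν) / (C₀ * (L + α)) * (C₀ * V ^ (-(2 / ν)) * (D + α * a)) := by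
        exact mul_le_mul_of_nonneg_left (h1.trans hsob) (by positivity)
    _ = (V ^ (2 / ν) * V ^ (-(2 / ν))) * (L * (D + α * a) / (L + α)) := by
        field_simp
    _ = L * (D + α * a) / (L + α) := by rw [h2, one_mul]
    -- After clearing the denominator this is the Poincaré inequality multiplied by α.
    _ ≤ D := by
        rw [div_le_iff₀ hLα]
        nlinarith

variable {n : ℕ} {H : Type*} [TopologicalSpace H]
    {I : ModelWithCorners ℝ (EuclideanSpace ℝ (Fin n)) H}
    {M : Type*} [TopologicalSpace M] [ChartedSpace H M]

variable [RiemannianBundle (fun x : M ↦ TangentSpace I x)] [MeasurableSpace M] {φ : M → ℝ}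

lemma HasGradient.const (c : ℝ) : HasGradient I φ (fun _ : M ↦ c) (fun _ ↦ 0) :=
  ⟨fun _ _ ↦ c, fun _ ↦ contMDiff_const, by simp, by simp [gradient_const], by simp,
    by simp [gradient_const]⟩

/-- The constant function 1 is in H¹ with zero gradient for any measure, and the inequality includes
integrability of its power. -/
lemma SobolevInequality.isFiniteMeasure {ν α C₀ : ℝ} (h : SobolevInequality I (M := M) φ ν α C₀) :
    IsFiniteMeasure (weightedVolume I φ) := by
  have h1 := (h _ _ (HasGradient.const 1)).1
  simpa [integrable_const_iff] using h1

/-- For u = 1 the right-hand side is C₀ V^{-2/ν} Vα, which must dominate a positive number. -/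
lemma SobolevInequality.pos {ν α C₀ : ℝ} (h : SobolevInequality I (M := M) φ ν α C₀)
    (hC₀ : 0 < C₀) (hV : 0 < (weightedVolume I φ).real univ) : 0 < α := by
  have h1 := (h _ _ (HasGradient.const 1)).2
  simp only [abs_one, Real.one_rpow, integral_const, smul_eq_mul, mul_one, norm_zero, ne_eq,
    OfNat.ofNat_ne_zero, not_false_eq_true, zero_pow, one_pow, zero_add] at h1
  by_contra! hα
  have h2 : 0 < (weightedVolume I φ).real univ ^ ((ν - 2) / ν) := by positivity
  have h3 : C₀ * (weightedVolume I φ).real univ ^ (-(2 / ν)) *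
      ((weightedVolume I φ).real univ * α) ≤ 0 :=
    mul_nonpos_of_nonneg_of_nonpos (by positivity) (mul_nonpos_of_nonneg_of_nonpos hV.le hα)
  linarith

end Nash

end BakryEmery

end

theorem lemma2 {n : ℕ} {H : Type*} [TopologicalSpace H]
    (I : ModelWithCorners ℝ (EuclideanSpace ℝ (Fin n)) H)
    {M : Type*} [TopologicalSpace M] [T2Space M] [CompactSpace M] [ConnectedSpace M]
    [MeasurableSpace M] [BorelSpace M]
    [ChartedSpace H M] [IsManifold I ∞ M]
    [RiemannianBundle (fun x : M ↦ TangentSpace I x)]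
    [IsContMDiffRiemannianBundle I ∞ (EuclideanSpace ℝ (Fin n)) (fun x : M ↦ TangentSpace I x)]
    (φ : M → ℝ) (hφ : ContMDiff I 𝓘(ℝ, ℝ) 2 φ)
    (ν α C₀ : ℝ) (hν : 2 < ν) (hC₀ : 0 < C₀)
    (hS : BakryEmery.SobolevInequality I (M := M) φ ν α C₀)
    (u : M → ℝ) (X : (x : M) → TangentSpace I x) (hu : BakryEmery.HasGradient I φ u X)
    (hmean : ∫ x, u x ∂BakryEmery.weightedVolume I φ = 0) :
    ∫ x, ‖X x‖ ^ 2 ∂BakryEmery.weightedVolume I φ ≥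
      BakryEmery.firstEigenvalue I φ * (BakryEmery.weightedVolume I φ).real univ ^ (2 / ν) /
          (C₀ * (BakryEmery.firstEigenvalue I φ + α)) *
        (∫ x, u x ^ 2 ∂BakryEmery.weightedVolume I φ) ^ ((2 + ν) / ν) *
        (∫ x, |u x| ∂BakryEmery.weightedVolume I φ) ^ (-(4 / ν)) := by
  -- The supporting lemmas need only a C¹ atlas, a continuous metric and a continuous weight.
  have hI1 : IsManifold I 1 M := IsManifold.of_le (n := ∞) (by norm_cast)
  have hR0 : IsContMDiffRiemannianBundle I 0 (EuclideanSpace ℝ (Fin n))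
      (fun x : M ↦ TangentSpace I x) := IsContMDiffRiemannianBundle.of_le (n := ∞) (by norm_cast)
  have hfin : IsFiniteMeasure (BakryEmery.weightedVolume I φ) := hS.isFiniteMeasure
  have hu2 := hu.memLp.integrable_sq
  have hX2 := hu.memLp_norm.integrable_sq
  rcases (measureReal_nonneg (μ := BakryEmery.weightedVolume I φ) (s := univ)).eq_or_lt with hV | hV
  · have h0 : BakryEmery.weightedVolume I φ = 0 := by
      rw [← Measure.measure_univ_eq_zero, ← measureReal_eq_zero_iff]
      exact hV.symm
    have : (2 + ν) / ν ≠ 0 := by positivity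
    simp [h0, Real.zero_rpow this]
  · obtain ⟨hup, hsob⟩ := hS u X hu
    have hexp : ∫ x, (‖X x‖ ^ 2 + α * |u x| ^ 2) ∂BakryEmery.weightedVolume I φ =
        ∫ x, ‖X x‖ ^ 2 ∂BakryEmery.weightedVolume I φ +
          α * ∫ x, u x ^ 2 ∂BakryEmery.weightedVolume I φ := by
      simp only [sq_abs]
      rw [integral_add hX2 (hu2.const_mul α), integral_const_mul]
    rw [hexp] at hsob
    exact BakryEmery.nash_of_sobolev_of_poincare hν hC₀ BakryEmery.firstEigenvalue_nonneg hV
      (hS.pos hC₀ hV) (integral_nonneg fun x ↦ sq_nonneg _) (integral_nonneg fun x ↦ abs_nonneg _)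
      (BakryEmery.integral_sq_le_interpolation hν (hu.memLp.integrable (by norm_num)) hu2 hup)
      hsob (hu.firstEigenvalue_mul_le hφ.continuous hmean)
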